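/- **Setting.** Let $\mathcal C$ be a class of measurable binary classifiers on a measurable space $X$ with finite VC dimension $d$, let $\mathcal D$ be any probability distribution on $X$ and $c\in\mathcal C$ the target. A crowd $W$ consists of $n\ge 1$ workers with noise rates $0\le\eta_i\le\frac12$; $\bar\eta_W=\frac1n\sum_i\eta_i$ is the average noise rate and $\bar\eta^*_{1,W}=\min_i\eta_i$ the best one. Data points $x_1,x_2,\dots$ are drawn i.i.d. from $\mathcal D$; worker $i$ answers $c(x_j)$ on the data point number $j$, flipped with probability $\eta_i$, independently over all pairs $(i,j)$, and gives the same answer whenever asked again about data point $j$. A task is one request to one worker for the label of one data point. Worker $i$ is $\Delta$-optimal if $\eta_i\le\bar\eta^*_{1,W}+\Delta$. A (measurable) learning rule is given that returns, for every labelled sample, some $h\in\mathcal C$ with the least number of disagreements. **Algorithm** with parameters $T$, $m\le n$, $M$. Step 1: for each of $T$ data points take the majority vote of $m$ distinct workers chosen at random. Step 2: ask every worker about these $T$ points and pick a worker with the highest agreement with the majority labels. Step 3: let this one worker label $M$ fresh data points, and return the $h\in\mathcal C$ that the learning rule gives on this labelled sample. **Theorem 6.** There are universal constants $c_0,K>0$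 and $k\in\mathbb N$ such that the following holds. Let $\epsilon>0$, $0<\delta\le\frac12$, assume $\bar\eta_W<\frac12$, that at least one worker is perfect ($\eta_i=0$ for some $i$), and that the crowd is large enough for the majority votes of Step 1, i.e. $n\ge c_0\,\log\!\big(\log(n/\delta)/\delta\big)/(1-2\bar\eta_W)^2$. Put $$g=\frac{\log^2(n/\delta)}{(1-2\bar\eta_W)^2}+\Big(n+\frac d\epsilon\Big)\log\frac1\delta .$$ Then $T,m,M$ can be chosen, depending only on $n,d,\epsilon,\delta,\bar\eta_W$, such that the algorithm uses at most $K\,g\,\log^k(2+g)$ tasks, i.e. $\tilde{\mathcal O}(g)$ tasks, and at most $K\,g\,\log^k(2+g)$ data points and elementary steps besides a single call of the learning rule, and such that, for all $X,\mathcal C,\mathcal D,c$ and all noise rates as above, with probability at least $1-\delta$ the worker picked in Step 2 is $\frac14$-optimal and the returned $h\in\mathcal C$ satisfies $\Pr_{x\sim\mathcal D}[h(x)\ne c(x)]<\epsilon$. -/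

import Mathlib

open MeasureTheory ProbabilityTheory

namespace CrowdPAC

/-! ### Concept classes -/

/-- The class `C` of binary classifiers realises every labelling of the finite set `s`. -/
def Shatters {X : Type*} (C : Set (X → Bool)) (s : Finset X) : Prop :=
  ∀ f : X → Bool, ∃ h ∈ C, ∀ x ∈ s, h x = f x

/-- The class `C` has VC dimension exactly `d`. -/
def HasVCDim {X : Type*} (C : Set (X → Bool)) (d : ℕ) : Prop :=
  (∃ s : Finset X, s.card = d ∧ Shatters C s) ∧ ∀ s : Finset X, Shatters C s → s.card ≤ d

/-- The error `Pr_{x ∼ D} [h x ≠ c x]` of the hypothesis `h` for the target `c`. -/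
noncomputable def err {X : Type*} [MeasurableSpace X] (D : Measure X) (h c : X → Bool) : ℝ :=
  D.real {x | h x ≠ c x}

/-- The number of examples of a labelled sample with which `h` disagrees. -/
def disagreements {X : Type*} {m : ℕ} (h : X → Bool) (s : Fin m → X × Bool) : ℕ :=
  (Finset.univ.filter fun j => h (s j).1 ≠ (s j).2).card

/-- `A` is a (measurable) learning rule that returns, for every labelled sample, a hypothesis of `C`
with the minimal number of disagreements. -/
structure IsERM {X : Type*} [MeasurableSpace X] (C : Set (X → Bool))
    (A : (m : ℕ) → (Fin m → X × Bool) → X → Bool) : Prop where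
  mem : ∀ m s, A m s ∈ C
  minimizes : ∀ m s, ∀ h ∈ C, disagreements (A m s) s ≤ disagreements h s
  measurable : ∀ m, Measurable fun p : (Fin m → X × Bool) × X => A m p.1 p.2

/-! ### The crowd -/

/-- A crowd of `n` workers, given by their noise rates `0 ≤ ηᵢ ≤ 1/2`. -/
structure Crowd (n : ℕ) where
  η : Fin n → unitInterval
  le_half : ∀ i, (η i : ℝ) ≤ 1 / 2

/-- The average noise rate of the workers. -/
noncomputable def Crowd.avg {n : ℕ} (W : Crowd n) : ℝ := (∑ i, (W.η i : ℝ)) / n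

/-- The noise rate of the best worker. -/
noncomputable def Crowd.best {n : ℕ} (W : Crowd n) : ℝ := ⨅ i, (W.η i : ℝ)

/-- Worker `i` is `Δ`-optimal. -/
def Crowd.IsOptimal {n : ℕ} (W : Crowd n) (Δ : ℝ) (i : Fin n) : Prop :=
  (W.η i : ℝ) ≤ W.best + Δ

/-! ### Computations with resource accounting -/

/-- The result of a computation, with the number of tasks (labels requested from workers), of
elementary steps, and of calls to the disagreement minimiser that it used. -/
structure Counted (α : Type*) where
  val : α
  tasks : ℕ
  steps : ℕ
  ermCalls : ℕ

namespace Counted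

/-- Run `p`, then run `f` on its result. -/
def bind {α β : Type*} (p : Counted α) (f : α → Counted β) : Counted β :=
  ⟨(f p.val).val, p.tasks + (f p.val).tasks, p.steps + (f p.val).steps,
    p.ermCalls + (f p.val).ermCalls⟩

/-- Run `f 0, …, f (k - 1)` and collect the results. -/
def forAll {α : Type*} {k : ℕ} (f : Fin k → Counted α) : Counted (Fin k → α) :=
  ⟨fun i => (f i).val, ∑ i, (f i).tasks, ∑ i, (f i).steps, ∑ i, (f i).ermCalls⟩

/-- A computation on data already at hand, of `k` elementary steps. -/
def compute {α : Type*} (k : ℕ) (a : α) : Counted α := ⟨a, 0, k, 0⟩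

/-- Ask worker `i` for the label of the data point number `j`: one task. -/
def ask {n N : ℕ} (label : Fin n → Fin N → Bool) (i : Fin n) (j : Fin N) : Counted Bool :=
  ⟨label i j, 1, 1, 0⟩

/-- One call of the disagreement minimiser `A` on a labelled sample. -/
def callERM {X : Type*} (A : (m : ℕ) → (Fin m → X × Bool) → X → Bool) {m : ℕ}
    (s : Fin m → X × Bool) : Counted (X → Bool) :=
  ⟨A m s, 0, 1, 1⟩

end Counted

open Counted

/-! ### The three-step algorithm -/

/-- The parameters of the algorithm for `n` workers: the number `T` of data points labelled by
majority vote, the number `m ≤ n` of voters for each of them, and the number `M` of further data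
points labelled by the worker that was identified. -/
structure Params (n : ℕ) where
  T : ℕ
  m : ℕ
  M : ℕ
  m_le : m ≤ n

/-- The majority vote (ties count as `false`). -/
def majority {m : ℕ} (v : Fin m → Bool) : Bool :=
  decide (m < 2 * (Finset.univ.filter fun k => v k = true).card)

/-- Step 1: for each of the first `T` data points, ask the first `m` workers of a random ordering of
the crowd (at a cost of `n` steps for the ordering) and take the majority vote (`m` steps). -/
def groundTruth {n : ℕ} (p : Params n) (label : Fin n → Fin (p.T + p.M) → Bool)
    (order : Fin p.T → Equiv.Perm (Fin n)) : Counted (Fin p.T → Bool) :=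
  forAll fun j =>
    (forAll fun k : Fin p.m =>
      ask label (order j (Fin.castLE p.m_le k)) (Fin.castAdd p.M j)).bind fun v =>
    compute (n + p.m) (majority v)

/-- Step 2: ask every worker about the `T` ground-truth points, count the agreements with the
ground truth `g` (`T` steps for each worker), and return the worker of the largest empirical accuracy
(`n` steps; the first one in case of a tie). -/
def identifyWorker {n : ℕ} [NeZero n] (p : Params n) (label : Fin n → Fin (p.T + p.M) → Bool)
    (g : Fin p.T → Bool) : Counted (Fin n) :=
  (forAll fun i : Fin n =>
    (forAll fun j : Fin p.T => ask label i (Fin.castAdd p.M j)).bind fun v =>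
    compute p.T (Finset.univ.filter fun j => v j = g j).card).bind fun score =>
  compute n (((List.finRange n).argmax score).getD 0)

/-- Step 3: ask worker `i` for the labels of the `M` remaining data points, and return a hypothesis
with the least number of disagreements with these labels. -/
def noisyLearn {X : Type*} {n : ℕ} (p : Params n)
    (A : (m : ℕ) → (Fin m → X × Bool) → X → Bool) (x : Fin (p.T + p.M) → X)
    (label : Fin n → Fin (p.T + p.M) → Bool) (i : Fin n) : Counted (X → Bool) :=
  (forAll fun j : Fin p.M =>
    (ask label i (Fin.natAdd p.T j)).bind fun y =>
    compute 1 (x (Fin.natAdd p.T j), y)).bind fun s =>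
  callERM A s

/-- The whole algorithm; it returns the worker identified in Step 2 and the classifier. -/
def crowdLearn {X : Type*} {n : ℕ} [NeZero n] (p : Params n)
    (A : (m : ℕ) → (Fin m → X × Bool) → X → Bool) (x : Fin (p.T + p.M) → X)
    (label : Fin n → Fin (p.T + p.M) → Bool) (order : Fin p.T → Equiv.Perm (Fin n)) :
    Counted (Fin n × (X → Bool)) :=
  (groundTruth p label order).bind fun g =>
  (identifyWorker p label g).bind fun i =>
  (noisyLearn p A x label i).bind fun h =>
  compute 0 (i, h)

/-! ### The random experiment -/

instance permMeasurableSpace (n : ℕ) : MeasurableSpace (Equiv.Perm (Fin n)) := ⊤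

instance permDiscrete (n : ℕ) : DiscreteMeasurableSpace (Equiv.Perm (Fin n)) :=
  ⟨fun _ => trivial⟩

/-- An outcome: the data points, the noise bits (`z i j` says whether worker `i` mislabels data
point `j`), and the random orderings of the crowd. -/
abbrev Outcome (X : Type*) {n : ℕ} (p : Params n) :=
  (Fin (p.T + p.M) → X) × (Fin n → Fin (p.T + p.M) → Bool) × (Fin p.T → Equiv.Perm (Fin n))

/-- The law of the outcome: data points drawn i.i.d. from `D`; the noise bits independent of them
and of each other, with `Pr [z i j = true] = ηᵢ`; and independent uniform orderings. -/
noncomputable def law {X : Type*} [MeasurableSpace X] {n : ℕ} (D : Measure X) (W : Crowd n)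
    (p : Params n) : Measure (Outcome X p) :=
  (Measure.pi fun _ => D).prod
    ((Measure.pi fun i => Measure.pi fun _ => bernoulliMeasure true false (W.η i)).prod
      (Measure.pi fun _ => uniformOn Set.univ))

/-- The answers of the workers for the target `c`. They are persistent: the answer of worker `i`
about data point `j` is the same each time it is asked for. -/
def answers {X : Type*} {n N : ℕ} (c : X → Bool) (x : Fin N → X) (z : Fin n → Fin N → Bool) :
    Fin n → Fin N → Bool :=
  fun i j => xor (c (x j)) (z i j)

/-- The run of the algorithm on an outcome. -/
def run {X : Type*} {n : ℕ} [NeZero n] (p : Params n)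
    (A : (m : ℕ) → (Fin m → X × Bool) → X → Bool) (c : X → Bool) (ω : Outcome X p) :
    Counted (Fin n × (X → Bool)) :=
  crowdLearn p A ω.1 (answers c ω.1 ω.2.1) ω.2.2

/-! ### The bound -/

/-- `log²(n/δ) / (1 - 2a)² + (n + d/ε) log(1/δ)`. -/
noncomputable def rate (n d : ℕ) (ε δ a : ℝ) : ℝ :=
  Real.log (n / δ) ^ 2 / (1 - 2 * a) ^ 2 + (n + d / ε) * Real.log (1 / δ)

/-- The functions `K g logᵏ (2 + g)`, whose union over `K` and `k` is the class `Õ(g)`. -/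
noncomputable def softBound (K : ℝ) (k : ℕ) (g : ℝ) : ℝ := K * g * Real.log (2 + g) ^ k

end CrowdPAC

open CrowdPAC

namespace CrowdPAC

open Counted

/-! ### Product measures -/

/-! Write `γ = 1 - 2a` and `L = log (n/δ)`. All probabilistic estimates are Chernoff bounds: the bad
event forces a product of independent nonnegative weights to be large, and the mean of that product
factors. Union bounds then combine them.

Majority votes. For a fixed ordering the voters err independently. Their noise rates are drawn
without replacement, but by Maclaurin's inequality (`sum_perm_prod_le`) the mean of the product of
weights is at most what it would be with replacement. A vote is therefore wrong with probability at
most `(1 - γ²/2)^m` (`measure_wrong_votes_le`), and `m` of order `log (L/δ) / γ²` makes all `T =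
O(L)` votes right.

Identification. A perfect worker almost surely agrees with `T` correct majority labels, so the
worker picked has made no error on them either (`run_worker_correct`). A worker with noise above
`1/4` achieves that with probability at most `(3/4)^T`.

Learning. The worker picked thus has noise at most `1/4`. A disagreement minimiser `h` sees at least
as many noisy as clean labels where `h ≠ c` (`card_clean_errors_le`), which is unlikely if `h` errs
often. This becomes uniform over the class by a ghost sample, random swaps of the double sample, and
the Sauer–Shelah bound of `(2M+1)^d` traces (`measure_noisy_erm_le`). The exponent is linear in
`εM`, so `M` is of order `d/ε` up to logarithms, as in noiseless learning.

The choice of the worker is random, so the last two estimates are united over all `n` workers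
instead of being conditioned on the choice (`law_failure_le`). This only puts `n` inside logarithms.
Since `m ≤ n`, the cost is of order `nT + n + M` (`resources_le`). -/

theorem lintegral_pi_prod {ι : Type*} [Fintype ι] {Ω : ι → Type*} [∀ i, MeasurableSpace (Ω i)]
    (μ : ∀ i, Measure (Ω i)) [∀ i, IsProbabilityMeasure (μ i)] (f : ∀ i, Ω i → ENNReal)
    (hf : ∀ i, Measurable (f i)) :
    ∫⁻ ω, ∏ i, f i (ω i) ∂Measure.pi μ = ∏ i, ∫⁻ x, f i x ∂μ i := by
  have hind : iIndepFun (fun i (ω : ∀ i, Ω i) => f i (ω i)) (Measure.pi μ) :=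
    iIndepFun_pi fun i => (hf i).aemeasurable
  have h := lintegral_prod_eq_prod_lintegral_of_indepFun Finset.univ _ hind
    fun i => (hf i).comp (measurable_pi_apply i)
  rw [h]
  refine Finset.prod_congr rfl fun i _ => ?_
  exact (measurePreserving_eval μ i).lintegral_comp (hf i)

/-- Markov's inequality for a product of independent nonnegative factors. -/
theorem pi_measure_le_prod {ι : Type*} [Fintype ι] {Ω : ι → Type*} [∀ i, MeasurableSpace (Ω i)]
    (μ : ∀ i, Measure (Ω i)) [∀ i, IsProbabilityMeasure (μ i)] (f : ∀ i, Ω i → ENNReal)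
    (hf : ∀ i, Measurable (f i)) (S : Set (∀ i, Ω i)) (a : ENNReal)
    (hS : ∀ ω ∈ S, 1 ≤ a * ∏ i, f i (ω i)) :
    Measure.pi μ S ≤ a * ∏ i, ∫⁻ x, f i x ∂μ i := by
  have hm : Measurable fun ω : ∀ i, Ω i => ∏ i, f i (ω i) :=
    Finset.measurable_prod _ fun i _ => (hf i).comp (measurable_pi_apply i)
  rw [← lintegral_pi_prod μ f hf, ← lintegral_const_mul _ hm]
  exact meas_le_lintegral₀ (hm.const_mul a).aemeasurable hS

theorem lintegral_bernoulli (p : unitInterval) (f : Bool → ENNReal) :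
    ∫⁻ b, f b ∂bernoulliMeasure true false p =
      ENNReal.ofReal p * f true + ENNReal.ofReal (1 - p) * f false := by
  rw [bernoulliMeasure_def, lintegral_add_measure, lintegral_smul_measure, lintegral_smul_measure,
    lintegral_dirac, lintegral_dirac]
  congr 1
  · rw [ENNReal.smul_def, smul_eq_mul]; congr 1
    rw [ENNReal.ofReal, Real.toNNReal_of_nonneg p.2.1]; rfl
  · rw [ENNReal.smul_def, smul_eq_mul]; congr 1
    rw [ENNReal.ofReal, Real.toNNReal_of_nonneg (by linarith [p.2.2])]; rfl

/-- Restricting the index set of a product of probability measures. -/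
theorem measurePreserving_pi_comp {ι κ : Type*} [Fintype ι] [Fintype κ] {Ω : Type*}
    [MeasurableSpace Ω] (μ : Measure Ω) [IsProbabilityMeasure μ] (e : ι → κ)
    (he : Function.Injective e) :
    MeasurePreserving (fun (ω : κ → Ω) i => ω (e i)) (Measure.pi fun _ => μ)
      (Measure.pi fun _ => μ) := by
  classical
  have hm : Measurable fun (ω : κ → Ω) i => ω (e i) := by fun_prop
  refine ⟨hm, (Measure.pi_eq fun s hs => ?_).symm⟩
  rw [Measure.map_apply hm (MeasurableSet.univ_pi hs)]
  have hset : (fun (ω : κ → Ω) i => ω (e i)) ⁻¹' Set.univ.pi s =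
      Set.univ.pi fun k => {y | ∀ i, e i = k → y ∈ s i} := by
    ext ω
    simp only [Set.mem_preimage, Set.mem_pi, Set.mem_univ, true_implies, Set.mem_ofPred_eq]
    exact ⟨fun h k i hi => hi ▸ h i, fun h i => h _ i rfl⟩
  rw [hset, Measure.pi_pi]
  have h1 : ∀ i, {y | ∀ i', e i' = e i → y ∈ s i'} = s i := fun i => by
    ext y
    exact ⟨fun h => h i rfl, fun h i' hi' => he hi' ▸ h⟩
  rw [← Finset.prod_subset (Finset.subset_univ (Finset.univ.image e)),
    Finset.prod_image fun _ _ _ _ h => he h]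
  · simp_rw [h1]
  · intro k _ hk
    have : {y | ∀ i, e i = k → y ∈ s i} = Set.univ := by
      ext y
      simp only [Set.mem_ofPred_eq, Set.mem_univ, iff_true]
      rintro i rfl
      exact absurd (Finset.mem_image_of_mem e (Finset.mem_univ i)) hk
    rw [this, measure_univ]

/-! ### Sampling without replacement -/

/-- Maclaurin's inequality: the mean of a product of samples drawn without replacement is at most
the product of the means. One step of the induction. -/
theorem sum_perm_prod_insert_le {ι : Type*} [Fintype ι] [DecidableEq ι] (x : ι → ℝ)
    (hx : ∀ i, 0 ≤ x i) (A : Finset ι) (a : ι) (ha : a ∉ A) :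
    Fintype.card ι * ∑ σ : Equiv.Perm ι, ∏ i ∈ insert a A, x (σ i) ≤
      (∑ i, x i) * ∑ σ : Equiv.Perm ι, ∏ i ∈ A, x (σ i) := by
  -- For `k ∉ A` both sides agree by symmetry. For `k ∈ A` the claim is `2 x(σ a) x(σ k) ≤ x(σ a)² +
  -- x(σ k)²`, summed over `σ` and symmetrised by the swap of `a` and `k`. Summing over `k` replaces
  -- the extra draw by the factor `∑ i, x i`.
  have key : ∀ k, ∑ σ : Equiv.Perm ι, x (σ a) * ∏ i ∈ A, x (σ i) ≤
      ∑ σ : Equiv.Perm ι, x (σ k) * ∏ i ∈ A, x (σ i) := by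
    intro k
    have swap_sum : ∀ F : Equiv.Perm ι → ℝ, ∑ σ, F σ = ∑ σ, F (σ * Equiv.swap a k) := fun F =>
      (Equiv.sum_comp (Equiv.mulRight (Equiv.swap a k)) F).symm
    by_cases hk : k ∈ A
    · have hne : ∀ i ∈ A.erase k, Equiv.swap a k i = i := fun i hi =>
        Equiv.swap_apply_of_ne_of_ne (fun h => ha (h ▸ Finset.mem_of_mem_erase hi))
          (Finset.ne_of_mem_erase hi)
      set Q : Equiv.Perm ι → ℝ := fun σ => ∏ i ∈ A.erase k, x (σ i) with hQ
      have hQ0 : ∀ σ, 0 ≤ Q σ := fun σ => Finset.prod_nonneg fun i _ => hx _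
      have hQs : ∀ σ, Q (σ * Equiv.swap a k) = Q σ := fun σ =>
        Finset.prod_congr rfl fun i hi => by rw [Equiv.Perm.mul_apply, hne i hi]
      have hA : ∀ σ : Equiv.Perm ι, ∏ i ∈ A, x (σ i) = x (σ k) * Q σ := fun σ =>
        (Finset.mul_prod_erase A (fun i => x (σ i)) hk).symm
      simp_rw [hA]
      have h1 := swap_sum fun σ => x (σ k) * (x (σ k) * Q σ)
      simp only [hQs, Equiv.Perm.mul_apply, Equiv.swap_apply_right] at h1
      have h2 : 0 ≤ ∑ σ, (x (σ k) - x (σ a)) ^ 2 * Q σ :=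
        Finset.sum_nonneg fun σ _ => mul_nonneg (sq_nonneg _) (hQ0 σ)
      have h3 : ∑ σ, (x (σ k) - x (σ a)) ^ 2 * Q σ = ∑ σ, x (σ k) * (x (σ k) * Q σ) +
          ∑ σ, x (σ a) * (x (σ a) * Q σ) - 2 * ∑ σ, x (σ a) * (x (σ k) * Q σ) := by
        rw [Finset.mul_sum, ← Finset.sum_add_distrib, ← Finset.sum_sub_distrib]
        exact Finset.sum_congr rfl fun σ _ => by ring
      linarith
    · rw [swap_sum]
      refine le_of_eq (Finset.sum_congr rfl fun σ _ => ?_)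
      rw [Equiv.Perm.mul_apply, Equiv.swap_apply_left]
      congr 1
      refine Finset.prod_congr rfl fun i hi => ?_
      rw [Equiv.Perm.mul_apply, Equiv.swap_apply_of_ne_of_ne (by rintro rfl; exact ha hi)
        (by rintro rfl; exact hk hi)]
  calc Fintype.card ι * ∑ σ : Equiv.Perm ι, ∏ i ∈ insert a A, x (σ i)
      = ∑ _k : ι, ∑ σ : Equiv.Perm ι, x (σ a) * ∏ i ∈ A, x (σ i) := by
        simp_rw [Finset.prod_insert ha]
        rw [Finset.sum_const, nsmul_eq_mul, Finset.card_univ]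
    _ ≤ ∑ k, ∑ σ : Equiv.Perm ι, x (σ k) * ∏ i ∈ A, x (σ i) := Finset.sum_le_sum fun k _ => key k
    _ = (∑ i, x i) * ∑ σ : Equiv.Perm ι, ∏ i ∈ A, x (σ i) := by
        rw [Finset.sum_comm, Finset.mul_sum]
        refine Finset.sum_congr rfl fun σ _ => ?_
        rw [← Finset.sum_mul, Equiv.sum_comp σ x]

theorem sum_perm_prod_le {ι : Type*} [Fintype ι] [DecidableEq ι] [Nonempty ι] (x : ι → ℝ)
    (hx : ∀ i, 0 ≤ x i) (A : Finset ι) :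
    ∑ σ : Equiv.Perm ι, ∏ i ∈ A, x (σ i) ≤
      ((∑ i, x i) / Fintype.card ι) ^ A.card * Fintype.card (Equiv.Perm ι) := by
  induction A using Finset.induction_on with
  | empty => simp
  | insert a A ha ih =>
    have hc : (0 : ℝ) < Fintype.card ι := by exact_mod_cast Fintype.card_pos
    have h := sum_perm_prod_insert_le x hx A a ha
    rw [Finset.card_insert_of_notMem ha, pow_succ', mul_assoc]
    refine le_trans ?_ (mul_le_mul_of_nonneg_left ih
      (div_nonneg (Finset.sum_nonneg fun i _ => hx i) hc.le))
    rw [div_mul_eq_mul_div, le_div_iff₀ hc, mul_comm]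
    exact h

/-! ### Majority votes -/

theorem lintegral_uniformOn_univ {α : Type*} [Fintype α] [Nonempty α] [MeasurableSpace α]
    [DiscreteMeasurableSpace α] (f : α → ENNReal) :
    ∫⁻ x, f x ∂uniformOn Set.univ = (Fintype.card α : ENNReal)⁻¹ * ∑ x, f x := by
  rw [uniformOn, ProbabilityTheory.cond, Measure.restrict_univ, lintegral_smul_measure,
    lintegral_count, tsum_fintype, Measure.count_univ, smul_eq_mul]
  simp

/-- The inequality is not strict because a tie gives `false`, which is an error when `b = true`. -/
theorem le_two_mul_card_of_majority_ne {m : ℕ} (b : Bool) (v : Fin m → Bool)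
    (h : majority (fun k => xor b (v k)) ≠ b) :
    m ≤ 2 * (Finset.univ.filter fun k => v k = true).card := by
  cases b
  · simp [majority] at h
    exact h.le
  · simp [majority] at h
    have := Finset.card_filter_add_card_filter_not (s := (Finset.univ : Finset (Fin m)))
      (fun k => v k = true)
    simp at this
    omega

theorem measurable_apply_snd_eval {α β T : Type*} [MeasurableSpace α] [MeasurableSpace β]
    [Countable β] [DiscreteMeasurableSpace β] (t : T) (F : α → β → ENNReal)
    (hF : ∀ b, Measurable fun z => F z b) : Measurable fun q : α × (T → β) => F q.1 (q.2 t) := by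
  have h : Measurable fun q : α × β => F q.1 q.2 := measurable_from_prod_countable_left hF
  exact h.comp (measurable_fst.prodMk ((measurable_pi_apply t).comp measurable_snd))

/-- The number of errors among the `m` voters for one data point is rarely at least `m / 2`. -/
theorem measure_wrong_votes_le {n N T m : ℕ} [NeZero n] (W : Crowd n) (hm : m ≤ n)
    (hW : W.avg ≤ 1 / 2) (j : Fin N) (t : Fin T) :
    ((Measure.pi fun i => Measure.pi fun _ : Fin N => bernoulliMeasure true false (W.η i)).prod
      (Measure.pi fun _ : Fin T => uniformOn (Set.univ : Set (Equiv.Perm (Fin n)))))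
      {q | m ≤ 2 * (Finset.univ.filter fun k : Fin m =>
        q.1 (q.2 t (Fin.castLE hm k)) j = true).card} ≤
      ENNReal.ofReal ((1 - (1 - 2 * W.avg) ^ 2 / 2) ^ m) := by
  classical
  set γ : ℝ := 1 - 2 * W.avg with hγ
  have hγ0 : 0 ≤ γ := by linarith
  -- Each wrong vote gets weight `r`, so `m ≤ 2 · #wrong` forces the product of weights up to `(1 +
  -- γ)^m`. Unlike the optimal weight `(1 + γ)/(1 - γ)`, this one stays finite at `γ = 1`.
  set r : ℝ := (1 + γ) ^ 2 with hr
  have hr1 : 1 ≤ r := by nlinarith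
  set φ : Bool → ℝ := fun b => if b then r else 1 with hφ
  have hφ0 : ∀ b, 0 ≤ φ b := fun b => by cases b <;> simp [hφ]; linarith
  set A : Finset (Fin n) := Finset.univ.map (Fin.castLEEmb hm) with hA
  have hAc : A.card = m := by simp [hA]
  set F : (Fin n → Fin N → Bool) → Equiv.Perm (Fin n) → ENNReal := fun z σ =>
    ENNReal.ofReal ((1 + γ)⁻¹ ^ m) * ∏ i ∈ A, ENNReal.ofReal (φ (z (σ i) j)) with hF
  have := isProbabilityMeasure_uniformOn (Set.finite_univ (α := Equiv.Perm (Fin n)))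
    Set.univ_nonempty
  have hFm : ∀ σ, Measurable fun z => F z σ := fun σ => Measurable.of_discrete
  have hFm' : Measurable fun q : (Fin n → Fin N → Bool) × (Fin T → Equiv.Perm (Fin n)) =>
      F q.1 (q.2 t) := measurable_apply_snd_eval t F hFm
  have hin : ∀ σ : Equiv.Perm (Fin n),
      ∫⁻ z, F z σ ∂(Measure.pi fun i => Measure.pi fun _ : Fin N =>
        bernoulliMeasure true false (W.η i)) =
      ENNReal.ofReal ((1 + γ)⁻¹ ^ m * ∏ i ∈ A, (1 + (W.η (σ i) : ℝ) * (r - 1))) := by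
    intro σ
    rw [lintegral_const_mul _ Measurable.of_discrete, ENNReal.ofReal_mul (by positivity)]
    congr 1
    -- Nonvoters contribute the factor `1`. Written over all workers, the product factors by
    -- independence of the rows of noise bits.
    have h1 : ∀ z : Fin n → Fin N → Bool, ∏ i ∈ A, ENNReal.ofReal (φ (z (σ i) j)) =
        ∏ w, if σ.symm w ∈ A then ENNReal.ofReal (φ (z w j)) else 1 := by
      intro z
      rw [← Equiv.prod_comp σ]
      simp only [Equiv.symm_apply_apply]
      rw [Finset.prod_ite_mem, Finset.univ_inter]
    simp_rw [h1]
    rw [lintegral_pi_prod _ (fun w (row : Fin N → Bool) =>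
      if σ.symm w ∈ A then ENNReal.ofReal (φ (row j)) else 1) fun w => Measurable.of_discrete]
    rw [ENNReal.ofReal_prod_of_nonneg fun i _ => by
      have := (W.η (σ i)).2.1
      nlinarith]
    rw [← Equiv.prod_comp σ]
    simp only [Equiv.symm_apply_apply]
    rw [← Finset.univ_inter A, ← Finset.prod_ite_mem]
    refine Finset.prod_congr rfl fun i _ => ?_
    simp only [Finset.univ_inter]
    split_ifs with hi
    · rw [(measurePreserving_eval (fun _ : Fin N => bernoulliMeasure true false (W.η (σ i)))
        j).lintegral_comp (f := fun b => ENNReal.ofReal (φ b)) Measurable.of_discrete,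
        lintegral_bernoulli]
      have h01 := (W.η (σ i)).2
      rw [← ENNReal.ofReal_mul h01.1, ← ENNReal.ofReal_mul (by linarith [h01.2]),
        ← ENNReal.ofReal_add (mul_nonneg h01.1 (hφ0 _))
          (mul_nonneg (by linarith [h01.2]) (hφ0 _))]
      congr 1
      simp [hφ]; ring
    · simp
  calc _ ≤ ∫⁻ q, F q.1 (q.2 t) ∂((Measure.pi fun i => Measure.pi fun _ : Fin N =>
        bernoulliMeasure true false (W.η i)).prod (Measure.pi fun _ : Fin T =>
          uniformOn (Set.univ : Set (Equiv.Perm (Fin n))))) := by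
        refine meas_le_lintegral₀ hFm'.aemeasurable fun q hq => ?_
        simp only [Set.mem_ofPred_eq] at hq
        set s := Finset.univ.filter fun k : Fin m => q.1 (q.2 t (Fin.castLE hm k)) j = true
        have hp : ∏ i ∈ A, φ (q.1 (q.2 t i) j) = r ^ s.card := by
          rw [hA, Finset.prod_map]
          simp [hφ, Finset.prod_ite, s]
        simp only [hF]
        rw [← ENNReal.ofReal_prod_of_nonneg fun i _ => hφ0 _, ← ENNReal.ofReal_mul (by positivity),
          hp, ← ENNReal.ofReal_one]
        refine ENNReal.ofReal_le_ofReal ?_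
        rw [inv_pow, inv_mul_eq_div, one_le_div (by positivity), hr, ← pow_mul]
        exact pow_le_pow_right₀ (by linarith) hq
    _ = ∫⁻ o, ENNReal.ofReal ((1 + γ)⁻¹ ^ m * ∏ i ∈ A, (1 + (W.η (o t i) : ℝ) * (r - 1)))
          ∂(Measure.pi fun _ : Fin T => uniformOn (Set.univ : Set (Equiv.Perm (Fin n)))) := by
        rw [lintegral_prod_symm _ hFm'.aemeasurable]
        exact lintegral_congr fun o => hin (o t)
    _ = (Fintype.card (Equiv.Perm (Fin n)) : ENNReal)⁻¹ * ENNReal.ofReal ((1 + γ)⁻¹ ^ m *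
          ∑ σ : Equiv.Perm (Fin n), ∏ i ∈ A, (1 + (W.η (σ i) : ℝ) * (r - 1))) := by
        rw [(measurePreserving_eval (fun _ : Fin T => uniformOn
          (Set.univ : Set (Equiv.Perm (Fin n)))) t).lintegral_comp (f := fun σ => ENNReal.ofReal
          ((1 + γ)⁻¹ ^ m * ∏ i ∈ A, (1 + (W.η (σ i) : ℝ) * (r - 1)))) Measurable.of_discrete,
          lintegral_uniformOn_univ, Finset.mul_sum _ _ ((1 + γ)⁻¹ ^ m), ENNReal.ofReal_sum_of_nonneg]
        intro σ _
        refine mul_nonneg (by positivity) (Finset.prod_nonneg fun i _ => ?_)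
        have := (W.η (σ i)).2.1
        nlinarith
    _ ≤ ENNReal.ofReal ((1 - γ ^ 2 / 2) ^ m) := by
        have hc : (0 : ℝ) < Fintype.card (Equiv.Perm (Fin n)) := by exact_mod_cast Fintype.card_pos
        rw [← ENNReal.ofReal_natCast, ← ENNReal.ofReal_inv_of_pos hc,
          ← ENNReal.ofReal_mul (by positivity)]
        refine ENNReal.ofReal_le_ofReal ?_
        have h := sum_perm_prod_le (fun i => 1 + (W.η i : ℝ) * (r - 1))
          (fun i => by have := (W.η i).2.1; nlinarith) A
        have hn : (n : ℝ) ≠ 0 := by exact_mod_cast NeZero.ne n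
        -- The mean weight exceeds the threshold `1 + γ` per voter by the factor `1 - γ²/2 < 1`
        -- only, i.e. falls below it; this ratio is the base of the final bound.
        have hmean : (∑ i, (1 + (W.η i : ℝ) * (r - 1))) / Fintype.card (Fin n) =
            (1 + γ) * (1 - γ ^ 2 / 2) := by
          have havg : W.avg = (1 - γ) / 2 := by rw [hγ]; ring
          rw [Finset.sum_add_distrib, ← Finset.sum_mul, Fintype.card_fin, add_div, mul_div_right_comm]
          rw [show (∑ i, (W.η i : ℝ)) / n = W.avg from rfl, havg]
          simp [hn, hr]
          ring
        rw [hmean, hAc, mul_pow] at h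
        calc _ ≤ _ := mul_le_mul_of_nonneg_left (mul_le_mul_of_nonneg_left h (by positivity))
                (by positivity)
          _ = _ := by
            have : (1 + γ) ^ m ≠ 0 := by positivity
            rw [inv_pow]
            field_simp

/-! ### The growth function -/

theorem sum_choose_le_pow (N d : ℕ) : ∑ k ∈ Finset.Iic d, N.choose k ≤ (N + 1) ^ d := by
  rw [add_pow]
  have : Finset.Iic d = Finset.range (d + 1) := by ext; simp
  rw [this]
  refine Finset.sum_le_sum fun k hk => ?_
  have hk' : k ≤ d := by simpa [Nat.lt_succ_iff] using hk
  calc N.choose k ≤ N ^ k := Nat.choose_le_pow N k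
    _ ≤ _ := by simpa using Nat.le_mul_of_pos_right _ (Nat.choose_pos hk')

open Classical in
/-- The restrictions of the hypotheses in `C` to a finite family of points. -/
noncomputable def traces {X ι : Type*} [Fintype ι] (C : Set (X → Bool)) (pts : ι → X) :
    Finset (ι → Bool) :=
  Finset.univ.filter fun g => ∃ h ∈ C, g = h ∘ pts

theorem comp_mem_traces {X ι : Type*} [Fintype ι] {C : Set (X → Bool)} (pts : ι → X)
    {h : X → Bool} (hh : h ∈ C) : h ∘ pts ∈ traces C pts := by
  simp only [traces, Finset.mem_filter, Finset.mem_univ, true_and]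
  exact ⟨h, hh, rfl⟩

/-- The Sauer–Shelah lemma. -/
theorem card_traces_le {X ι : Type*} [Fintype ι] {C : Set (X → Bool)} {d : ℕ}
    (hC : ∀ s : Finset X, Shatters C s → s.card ≤ d) (pts : ι → X) :
    (traces C pts).card ≤ (Fintype.card ι + 1) ^ d := by
  classical
  set S : (ι → Bool) → Finset ι := fun g => Finset.univ.filter fun i => g i = true with hS
  have hSinj : Function.Injective S := fun g g' h => by
    ext i
    have : i ∈ S g ↔ i ∈ S g' := by rw [h]
    simp only [hS, Finset.mem_filter, Finset.mem_univ, true_and] at this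
    exact Bool.eq_iff_iff.2 this ▸ rfl
  rw [← Finset.card_image_of_injective _ hSinj]
  refine (Finset.card_le_card_shatterer _).trans (Finset.card_shatterer_le_sum_vcDim.trans ?_)
  refine le_trans (Finset.sum_le_sum_of_subset ?_) (sum_choose_le_pow _ d)
  refine Finset.Iic_subset_Iic.2 (Finset.sup_le fun t ht => ?_)
  rw [Finset.mem_shatterer] at ht
  have hmem : ∀ t' ⊆ t, ∃ h ∈ C, ∀ i ∈ t, (h (pts i) = true ↔ i ∈ t') := by
    intro t' ht'
    obtain ⟨u, hu, hut⟩ := ht ht'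
    obtain ⟨g, hg, rfl⟩ := Finset.mem_image.1 hu
    obtain ⟨h, hh, rfl⟩ := (Finset.mem_filter.1 hg).2
    refine ⟨h, hh, fun i hi => ?_⟩
    rw [← hut]
    simp [hS, hi]
  -- Indices of the same point cannot be separated by a hypothesis, so a shattered index set maps
  -- injectively to a shattered set of points of equal size.
  have hinj : Set.InjOn pts t := by
    intro i hi j hj hij
    obtain ⟨h, -, hh⟩ := hmem {i} (by simpa using hi)
    have h1 := (hh i hi).2 (by simp)
    rw [hij] at h1
    exact (Finset.mem_singleton.1 ((hh j hj).1 h1)).symm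
  rw [← Finset.card_image_of_injOn hinj]
  refine hC _ fun f => ?_
  obtain ⟨h, hh, hht⟩ := hmem (t.filter fun i => f (pts i) = true) (Finset.filter_subset _ _)
  refine ⟨h, hh, fun x hx => ?_⟩
  obtain ⟨i, hi, rfl⟩ := Finset.mem_image.1 hx
  have := hht i hi
  simp only [Finset.mem_filter, hi, true_and] at this
  exact Bool.eq_iff_iff.2 this

/-! ### Learning from noisy labels -/

/-- A labelled sample with random classification noise `z`. -/
def noisySample {X : Type*} {M : ℕ} (c : X → Bool) (x : Fin M → X) (z : Fin M → Bool) :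
    Fin M → X × Bool :=
  fun j => (x j, xor (c (x j)) (z j))

/-- Where a disagreement minimiser differs from the target, at least half of the labels are
noisy. -/
theorem card_clean_errors_le {X : Type*} {M : ℕ} {c h : X → Bool} {x : Fin M → X}
    {z : Fin M → Bool}
    (hh : disagreements h (noisySample c x z) ≤ disagreements c (noisySample c x z)) :
    (Finset.univ.filter fun j => h (x j) ≠ c (x j) ∧ z j = false).card ≤
      (Finset.univ.filter fun j => h (x j) ≠ c (x j) ∧ z j = true).card := by
  -- `h` contradicts a label exactly when one, but not both, of the following holds: `h` errs there,
  -- the label is noisy. The noisy labels outside the error region count equally for `h` and `c` and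
  -- cancel.
  have h1 : disagreements h (noisySample c x z) =
      (Finset.univ.filter fun j => h (x j) ≠ c (x j) ∧ z j = false).card +
      (Finset.univ.filter fun j => ¬ h (x j) ≠ c (x j) ∧ z j = true).card := by
    rw [disagreements, ← Finset.card_union_of_disjoint]
    · congr 1
      ext j
      simp only [Finset.mem_filter, Finset.mem_univ, true_and, Finset.mem_union]
      simp only [noisySample]
      cases h (x j) <;> cases c (x j) <;> cases z j <;> simp
    · refine Finset.disjoint_filter.2 fun j _ hj hj' => hj'.1 hj.1
  have h2 : disagreements c (noisySample c x z) =
      (Finset.univ.filter fun j => h (x j) ≠ c (x j) ∧ z j = true).card +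
      (Finset.univ.filter fun j => ¬ h (x j) ≠ c (x j) ∧ z j = true).card := by
    rw [disagreements, ← Finset.card_union_of_disjoint]
    · congr 1
      ext j
      simp only [Finset.mem_filter, Finset.mem_univ, true_and, Finset.mem_union]
      simp only [noisySample]
      cases h (x j) <;> cases c (x j) <;> cases z j <;> simp
    · refine Finset.disjoint_filter.2 fun j _ hj hj' => hj'.1 hj.1
  omega

/-- A ghost sample hits a set of measure at least `ε` often enough. -/
theorem half_le_measure_hits {X : Type*} [MeasurableSpace X] (D : Measure X)
    [IsProbabilityMeasure D] {G : Set X} [DecidablePred (· ∈ G)] (hG : MeasurableSet G)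
    {ε : ℝ} (hε : ε ≤ D.real G)
    {M : ℕ} (hM : 4 ≤ ε * M) :
    2⁻¹ ≤ (Measure.pi fun _ : Fin M => D)
      {x | ⌊ε * M / 4⌋₊ ≤ (Finset.univ.filter fun j => x j ∈ G).card} := by
  set k := ⌊ε * M / 4⌋₊ with hk
  set S := {x : Fin M → X | k ≤ (Finset.univ.filter fun j => x j ∈ G).card} with hS
  have hSm : MeasurableSet S := by
    have hdec : Measurable fun x => decide (x ∈ G) := by
      refine measurable_to_bool ?_
      have : (fun x => decide (x ∈ G)) ⁻¹' {true} = G := by ext; simp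
      rwa [this]
    have : Measurable fun (x : Fin M → X) j => decide (x j ∈ G) :=
      measurable_pi_lambda _ fun j => hdec.comp (measurable_pi_apply j)
    have h := this (MeasurableSet.of_discrete
      (s := {v : Fin M → Bool | k ≤ (Finset.univ.filter fun j => v j = true).card}))
    convert h using 1
    ext x
    simp [hS]
  have hp1 : D.real G ≤ 1 := measureReal_le_one
  have hcompl : (Measure.pi fun _ : Fin M => D) Sᶜ ≤ 2⁻¹ := by
    -- Each hit gets weight `1/2`. With `p = D.real G ≥ ε` the bound is `2^k (1 - p/2)^M ≤ exp
    -- (-εM/4) ≤ exp (-1) ≤ 1/2`, where `4 ≤ εM` enters.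
    have h := pi_measure_le_prod (fun _ : Fin M => D)
      (fun _ x => G.indicator (fun _ => ENNReal.ofReal (1 / 2)) x + Gᶜ.indicator (fun _ => 1) x)
      (fun _ => (measurable_const.indicator hG).add (measurable_const.indicator hG.compl))
      Sᶜ (ENNReal.ofReal (2 ^ k)) ?_
    · refine h.trans ?_
      have hint : ∫⁻ x, (G.indicator (fun _ => ENNReal.ofReal (1 / 2)) x +
          Gᶜ.indicator (fun _ => 1) x) ∂D = ENNReal.ofReal (1 - D.real G / 2) := by
        rw [lintegral_add_left (measurable_const.indicator hG), lintegral_indicator_const hG,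
          lintegral_indicator_const hG.compl, one_mul, ← ofReal_measureReal (s := G),
          ← ofReal_measureReal (s := Gᶜ), probReal_compl_eq_one_sub hG,
          ← ENNReal.ofReal_mul (by norm_num), ← ENNReal.ofReal_add (by positivity) (by linarith)]
        congr 1; ring
      rw [hint, Finset.prod_const, Finset.card_univ, Fintype.card_fin,
        ← ENNReal.ofReal_pow (by linarith), ← ENNReal.ofReal_mul (by positivity)]
      have h2 : (2⁻¹ : ENNReal) = ENNReal.ofReal (1 / 2) := by
        rw [one_div, ENNReal.ofReal_inv_of_pos two_pos]; simp
      rw [h2]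
      refine ENNReal.ofReal_le_ofReal ?_
      have hk4 : (k : ℝ) ≤ ε * M / 4 := Nat.floor_le (by linarith)
      have e1 : (2 : ℝ) ^ k ≤ Real.exp (ε * M / 4) := by
        calc (2 : ℝ) ^ k ≤ Real.exp 1 ^ k :=
              pow_le_pow_left₀ (by norm_num) (by linarith [Real.add_one_le_exp (1 : ℝ)]) k
          _ = Real.exp k := by rw [← Real.exp_nat_mul, mul_one]
          _ ≤ _ := Real.exp_le_exp.2 hk4
      have e2 : (1 - D.real G / 2) ^ M ≤ Real.exp (-(ε * M / 2)) := by
        calc (1 - D.real G / 2) ^ M ≤ Real.exp (-(ε / 2)) ^ M := by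
              refine pow_le_pow_left₀ (by linarith) ?_ M
              linarith [Real.add_one_le_exp (-(ε / 2))]
          _ = _ := by rw [← Real.exp_nat_mul]; congr 1; ring
      calc (2 : ℝ) ^ k * (1 - D.real G / 2) ^ M
          ≤ Real.exp (ε * M / 4) * Real.exp (-(ε * M / 2)) :=
            mul_le_mul e1 e2 (pow_nonneg (by linarith) _) (Real.exp_pos _).le
        _ = Real.exp (-(ε * M / 4)) := by rw [← Real.exp_add]; congr 1; ring
        _ ≤ Real.exp (-1) := Real.exp_le_exp.2 (by linarith)
        _ ≤ 1 / 2 := by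
            rw [Real.exp_neg, one_div]
            exact inv_anti₀ two_pos (by linarith [Real.add_one_le_exp (1 : ℝ)])
    · intro x hx
      have hx' : (Finset.univ.filter fun j => x j ∈ G).card ≤ k := by
        simp [hS] at hx; exact hx.le
      have hprod : ∏ j, (G.indicator (fun _ => ENNReal.ofReal (1 / 2)) (x j) +
          Gᶜ.indicator (fun _ => 1) (x j)) =
          ENNReal.ofReal (1 / 2) ^ (Finset.univ.filter fun j => x j ∈ G).card := by
        rw [← Finset.prod_const, Finset.prod_filter]
        refine Finset.prod_congr rfl fun j _ => ?_
        by_cases hj : x j ∈ G <;> simp [hj]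
      rw [hprod, ← ENNReal.ofReal_pow (by norm_num), ← ENNReal.ofReal_mul (by positivity),
        ← ENNReal.ofReal_one]
      refine ENNReal.ofReal_le_ofReal ?_
      rw [one_div, inv_pow, ← div_eq_mul_inv, one_le_div (by positivity)]
      exact pow_le_pow_right₀ (by norm_num) hx'
  have h1 : 1 = (Measure.pi fun _ : Fin M => D) S + (Measure.pi fun _ : Fin M => D) Sᶜ := by
    rw [measure_add_measure_compl hSm, measure_univ]
  by_contra hlt
  push Not at hlt
  have := ENNReal.add_lt_add_of_lt_of_le (ne_top_of_le_ne_top (by simp) hcompl) hlt hcompl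
  rw [← h1, ENNReal.inv_two_add_inv_two] at this
  exact lt_irrefl _ this

/-- The double sample, with the pairs of points selected by `σ` swapped. -/
def swapPairs {X : Type*} {M : ℕ} (σ : Fin M → Bool) (q : (Fin M → X) × (Fin M → X)) :
    (Fin M → X) × (Fin M → X) :=
  (fun j => if σ j then q.2 j else q.1 j, fun j => if σ j then q.1 j else q.2 j)

/-- Regrouped into `M` pairs, the double sample has a product law with factors `D.prod D`, each
invariant under `Prod.swap`. -/
theorem measurePreserving_swapPairs {X : Type*} [MeasurableSpace X] (D : Measure X)
    [IsProbabilityMeasure D] {M : ℕ} (σ : Fin M → Bool) :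
    MeasurePreserving (swapPairs (X := X) σ)
      ((Measure.pi fun _ => D).prod (Measure.pi fun _ => D))
      ((Measure.pi fun _ => D).prod (Measure.pi fun _ => D)) := by
  have h1 := measurePreserving_arrowProdEquivProdArrow X X (Fin M) (fun _ => D) (fun _ => D)
  have h2 : MeasurePreserving (fun (a : Fin M → X × X) j => (if σ j then Prod.swap else id) (a j))
      (Measure.pi fun _ => D.prod D) (Measure.pi fun _ => D.prod D) := by
    refine measurePreserving_pi _ _ fun j => ?_
    cases σ j
    · exact MeasurePreserving.id _
    · exact Measure.measurePreserving_swap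
  have h3 := (h1.comp h2).comp (MeasurePreserving.symm _ h1)
  convert h3 using 1
  ext q j
  · simp only [swapPairs, Function.comp]
    cases hσ : σ j <;> simp [MeasurableEquiv.arrowProdEquivProdArrow, hσ,
      Equiv.arrowProdEquivProdArrow]
  · simp only [swapPairs, Function.comp]
    cases hσ : σ j <;> simp [MeasurableEquiv.arrowProdEquivProdArrow, hσ,
      Equiv.arrowProdEquivProdArrow]

/-- A fair coin and a noise bit of rate `η`. -/
noncomputable def coinNoise (η : unitInterval) : Measure (Bool × Bool) :=
  (bernoulliMeasure true false ⟨1 / 2, by norm_num, by norm_num⟩).prod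
    (bernoulliMeasure true false η)

instance (η : unitInterval) : IsProbabilityMeasure (coinNoise η) := by
  unfold coinNoise; infer_instance

/-- The factor by which a pair of points contributes to the moment generating function; `u b` says
whether the hypothesis errs on point `b` of the pair. -/
noncomputable def pairWeight (u : Bool → Bool) (w : Bool × Bool) : ℝ :=
  (if u w.1 then (if w.2 then 2 else 1 / 2) else 1) * (if u (!w.1) then 9 / 8 else 1)

theorem pairWeight_nonneg (u : Bool → Bool) (w : Bool × Bool) : 0 ≤ pairWeight u w := by
  unfold pairWeight
  split_ifs <;> norm_num

/-- An error on the training half has mean weight `2η + (1 - η)/2 ≤ 7/8` when `η ≤ 1/4`. If only one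
point of the pair is an error, the fair coin gives at most `(7/8 + 9/8)/2 = 1`, which dictates the
weight `9/8`. If both are, the mean is at most `7/8 · 9/8 < 1`. -/
theorem lintegral_pairWeight_le (η : unitInterval) (hη : (η : ℝ) ≤ 1 / 4) (u : Bool → Bool) :
    ∫⁻ w, ENNReal.ofReal (pairWeight u w) ∂coinNoise η ≤ 1 := by
  have h0 := η.2.1
  have h1 : ∀ b, ∫⁻ z, ENNReal.ofReal (pairWeight u (b, z)) ∂bernoulliMeasure true false η =
      ENNReal.ofReal (η * pairWeight u (b, true) + (1 - η) * pairWeight u (b, false)) := by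
    intro b
    rw [lintegral_bernoulli, ← ENNReal.ofReal_mul h0, ← ENNReal.ofReal_mul (by linarith),
      ← ENNReal.ofReal_add (mul_nonneg h0 (pairWeight_nonneg _ _))
        (mul_nonneg (by linarith) (pairWeight_nonneg _ _))]
  have h2 : ∀ b, 0 ≤ η * pairWeight u (b, true) + (1 - η) * pairWeight u (b, false) := fun b =>
    add_nonneg (mul_nonneg h0 (pairWeight_nonneg _ _))
      (mul_nonneg (by linarith) (pairWeight_nonneg _ _))
  rw [coinNoise, lintegral_prod _ Measurable.of_discrete.aemeasurable]
  simp_rw [h1]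
  rw [lintegral_bernoulli, ← ENNReal.ofReal_mul (by norm_num), ← ENNReal.ofReal_mul (by norm_num),
    ← ENNReal.ofReal_add (mul_nonneg (by norm_num) (h2 _)) (mul_nonneg (by norm_num) (h2 _)),
    ← ENNReal.ofReal_one]
  refine ENNReal.ofReal_le_ofReal ?_
  cases ht : u true <;> cases hf : u false <;> simp [pairWeight, ht, hf] <;> linarith

/-- If a hypothesis errs often on the second half of a randomly swapped double sample, then it
rarely errs on the first half mostly where the label is noisy. -/
theorem measure_pattern_le {M : ℕ} (η : unitInterval) (hη : (η : ℝ) ≤ 1 / 4)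
    (u : Fin M → Bool → Bool) (k : ℕ) :
    (Measure.pi fun _ : Fin M => coinNoise η)
      {w | (Finset.univ.filter fun j => u j (w j).1 = true ∧ (w j).2 = false).card ≤
          (Finset.univ.filter fun j => u j (w j).1 = true ∧ (w j).2 = true).card ∧
        k ≤ (Finset.univ.filter fun j => u j (!(w j).1) = true).card} ≤
      ENNReal.ofReal ((8 / 9) ^ k) := by
  refine (pi_measure_le_prod _ (fun j w => ENNReal.ofReal (pairWeight (u j) w))
    (fun _ => Measurable.of_discrete) _ (ENNReal.ofReal ((8 / 9) ^ k)) ?_).trans ?_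
  · rintro w ⟨hw, hk⟩
    rw [← ENNReal.ofReal_prod_of_nonneg fun j _ => pairWeight_nonneg _ _,
      ← ENNReal.ofReal_mul (by positivity), ← ENNReal.ofReal_one]
    refine ENNReal.ofReal_le_ofReal ?_
    set a := (Finset.univ.filter fun j => u j (w j).1 = true ∧ (w j).2 = false).card with ha
    set b := (Finset.univ.filter fun j => u j (w j).1 = true ∧ (w j).2 = true).card with hb
    set l := (Finset.univ.filter fun j => u j (!(w j).1) = true).card with hl
    have hprod : ∏ j, pairWeight (u j) (w j) = (1 / 2) ^ a * 2 ^ b * (9 / 8) ^ l := by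
      rw [ha, hb, hl, ← Finset.prod_const, ← Finset.prod_const, ← Finset.prod_const,
        Finset.prod_filter, Finset.prod_filter, Finset.prod_filter, ← Finset.prod_mul_distrib,
        ← Finset.prod_mul_distrib]
      refine Finset.prod_congr rfl fun j _ => ?_
      unfold pairWeight
      cases u j (w j).1 <;> cases (w j).2 <;> simp
    rw [hprod]
    have h1 : (1 : ℝ) ≤ (1 / 2) ^ a * 2 ^ b := by
      rw [one_div, inv_pow, inv_mul_eq_div, one_le_div (by positivity)]
      exact pow_le_pow_right₀ (by norm_num) hw
    have h2 : (1 : ℝ) ≤ (8 / 9) ^ k * (9 / 8) ^ l := by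
      calc (1 : ℝ) = (8 / 9) ^ k * (9 / 8) ^ k := by rw [← mul_pow]; norm_num
        _ ≤ _ := by gcongr; norm_num
    calc (1 : ℝ) ≤ ((1 / 2) ^ a * 2 ^ b) * ((8 / 9) ^ k * (9 / 8) ^ l) :=
          one_le_mul_of_one_le_of_one_le h1 h2
      _ = _ := by ring
  · exact mul_le_of_le_one_right' (Finset.prod_le_one' fun j _ => lintegral_pairWeight_le η hη (u j))

/-- Disagreement minimisation over a class of VC dimension at most `d` tolerates random
classification noise of rate at most `1/4`. -/
theorem measure_noisy_erm_le {X : Type*} [MeasurableSpace X] (D : Measure X)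
    [IsProbabilityMeasure D] {C : Set (X → Bool)} {d : ℕ}
    (hC : ∀ s : Finset X, Shatters C s → s.card ≤ d)
    {A : (m : ℕ) → (Fin m → X × Bool) → X → Bool} (hA : IsERM C A) {c : X → Bool} (hc : c ∈ C)
    (hcm : Measurable c) (η : unitInterval) (hη : (η : ℝ) ≤ 1 / 4) {ε : ℝ} {M : ℕ}
    (hM : 4 ≤ ε * M) :
    ((Measure.pi fun _ : Fin M => D).prod
      (Measure.pi fun _ : Fin M => bernoulliMeasure true false η))
      {q | ε ≤ err D (A M (noisySample c q.1 q.2)) c} ≤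
      2 * ENNReal.ofReal ((2 * M + 1) ^ d * (8 / 9) ^ ⌊ε * M / 4⌋₊) := by
  classical
  set P := Measure.pi fun _ : Fin M => D with hP
  set N := Measure.pi fun _ : Fin M => bernoulliMeasure true false η with hN
  set k := ⌊ε * M / 4⌋₊ with hk
  set H : (Fin M → X) → (Fin M → Bool) → X → Bool := fun x z => A M (noisySample c x z) with hH
  set B := {q : (Fin M → X) × (Fin M → Bool) | ε ≤ err D (H q.1 q.2) c} with hB
  have hHm : Measurable fun q : ((Fin M → X) × (Fin M → Bool)) × X => H q.1.1 q.1.2 q.2 := by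
    have hs : Measurable fun q : ((Fin M → X) × (Fin M → Bool)) × X =>
        (noisySample c q.1.1 q.1.2, q.2) := by
      refine Measurable.prodMk (measurable_pi_lambda _ fun j => ?_) measurable_snd
      have hx : Measurable fun q : ((Fin M → X) × (Fin M → Bool)) × X => q.1.1 j :=
        (measurable_pi_apply j).comp (measurable_fst.comp measurable_fst)
      have hz : Measurable fun q : ((Fin M → X) × (Fin M → Bool)) × X => q.1.2 j :=
        (measurable_pi_apply j).comp (measurable_snd.comp measurable_fst)
      have hxor : Measurable fun b : Bool × Bool => xor b.1 b.2 := Measurable.of_discrete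
      exact hx.prodMk (hxor.comp ((hcm.comp hx).prodMk hz))
    exact (hA.measurable M).comp hs
  have hne : Measurable fun q : ((Fin M → X) × (Fin M → Bool)) × X =>
      (H q.1.1 q.1.2 q.2, c q.2) := hHm.prodMk (hcm.comp measurable_snd)
  have hBm : MeasurableSet B := by
    have hset : MeasurableSet {q : ((Fin M → X) × (Fin M → Bool)) × X |
        H q.1.1 q.1.2 q.2 ≠ c q.2} :=
      hne (MeasurableSet.of_discrete (s := {b : Bool × Bool | b.1 ≠ b.2}))
    exact measurableSet_le measurable_const (measurable_measure_prodMk_left hset).ennreal_toReal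
  -- the ghost sample `x'` exhibits the errors
  set E : (Fin M → Bool) → Set ((Fin M → X) × (Fin M → X)) := fun z =>
    {q | k ≤ (Finset.univ.filter fun j => H q.1 z (q.2 j) ≠ c (q.2 j)).card} with hE
  have hEm : ∀ z, MeasurableSet (E z) := by
    intro z
    have hm : Measurable fun (q : (Fin M → X) × (Fin M → X)) j =>
        (H q.1 z (q.2 j), c (q.2 j)) := by
      refine measurable_pi_lambda _ fun j => ?_
      exact hne.comp (Measurable.prodMk (measurable_fst.prodMk measurable_const)
        ((measurable_pi_apply j).comp measurable_snd))
    exact hm (MeasurableSet.of_discrete (s := {v : Fin M → Bool × Bool |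
      k ≤ (Finset.univ.filter fun j => (v j).1 ≠ (v j).2).card}))
  -- The hypothesis does not depend on the ghost sample. A bad one is exposed there with probability
  -- at least `1/2`, whence the factor `2`.
  have hghost : ∀ z, P {x | (x, z) ∈ B} ≤ 2 * (P.prod P) (E z) := by
    intro z
    have hBz : MeasurableSet {x | (x, z) ∈ B} := (measurable_id.prodMk measurable_const) hBm
    have h1 : 2⁻¹ * P {x | (x, z) ∈ B} ≤ (P.prod P) (E z) := by
      rw [Measure.prod_apply (hEm z), ← lintegral_indicator_const hBz]
      refine lintegral_mono fun x => ?_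
      by_cases hx : (x, z) ∈ B
      · rw [Set.indicator_of_mem (by exact hx)]
        have hG : MeasurableSet {y | H x z y ≠ c y} :=
          (hne.comp (measurable_prodMk_left (x := (x, z))))
            (MeasurableSet.of_discrete (s := {b : Bool × Bool | b.1 ≠ b.2}))
        exact half_le_measure_hits D hG hx hM
      · rw [Set.indicator_of_notMem (by exact hx)]
        exact zero_le
    calc P {x | (x, z) ∈ B} = 2 * (2⁻¹ * P {x | (x, z) ∈ B}) := by
          rw [← mul_assoc, ENNReal.mul_inv_cancel two_ne_zero ENNReal.ofNat_ne_top, one_mul]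
      _ ≤ _ := mul_le_mul_right h1 2
  have hτ : MeasurePreserving (fun (w : Fin M → Bool × Bool) j => (w j).2)
      (Measure.pi fun _ => coinNoise η) N :=
    measurePreserving_pi _ _ fun _ => measurePreserving_snd
  -- The `2M` points are now fixed and only coins and noise are random. The hypothesis depends on
  -- them, so the union runs over all traces on these points. Noise bits belong to positions of the
  -- training half and are not swapped along with the points.
  have hcount : ∀ q : (Fin M → X) × (Fin M → X), (Measure.pi fun _ : Fin M => coinNoise η)
      {w | swapPairs (fun j => (w j).1) q ∈ E fun j => (w j).2} ≤
      ENNReal.ofReal ((2 * M + 1) ^ d * (8 / 9) ^ k) := by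
    intro q
    set pts : Fin M × Bool → X := fun i => if i.2 then q.2 i.1 else q.1 i.1 with hpts
    have hsw : ∀ σ : Fin M → Bool, swapPairs σ q =
        (fun j => pts (j, σ j), fun j => pts (j, !σ j)) := by
      intro σ
      refine Prod.ext (funext fun j => rfl) (funext fun j => ?_)
      simp only [swapPairs, hpts]
      cases σ j <;> rfl
    calc _ ≤ (Measure.pi fun _ : Fin M => coinNoise η) (⋃ g ∈ traces C pts,
          {w | (Finset.univ.filter fun j => (xor (g (j, (w j).1)) (c (pts (j, (w j).1)))) = true ∧
                (w j).2 = false).card ≤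
              (Finset.univ.filter fun j => (xor (g (j, (w j).1)) (c (pts (j, (w j).1)))) = true ∧
                (w j).2 = true).card ∧
            k ≤ (Finset.univ.filter fun j =>
              (xor (g (j, !(w j).1)) (c (pts (j, !(w j).1)))) = true).card}) := by
          refine measure_mono fun w hw => ?_
          simp only [Set.mem_ofPred_eq, hsw, hE] at hw
          set h := H (fun j => pts (j, (w j).1)) (fun j => (w j).2) with hh
          have hhC : h ∈ C := hA.mem _ _
          refine Set.mem_biUnion (x := h ∘ pts) (comp_mem_traces pts hhC) ?_
          have hmin := card_clean_errors_le (hA.minimizes M (noisySample c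
            (fun j => pts (j, (w j).1)) (fun j => (w j).2)) c hc)
          refine ⟨?_, ?_⟩
          · convert hmin using 6 <;> simp [hh, hH]
          · convert hw using 4
            simp
      _ ≤ ∑ g ∈ traces C pts, ENNReal.ofReal ((8 / 9) ^ k) := by
          refine (measure_biUnion_finset_le _ _).trans (Finset.sum_le_sum fun g _ => ?_)
          exact measure_pattern_le η hη (fun j b => xor (g (j, b)) (c (pts (j, b)))) k
      _ ≤ _ := by
          rw [Finset.sum_const, nsmul_eq_mul, ENNReal.ofReal_mul (by positivity)]
          refine mul_le_mul_left ?_ _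
          have := card_traces_le hC pts
          rw [Fintype.card_prod, Fintype.card_fin, Fintype.card_bool, mul_comm M] at this
          rw [← ENNReal.ofReal_natCast]
          exact ENNReal.ofReal_le_ofReal (by exact_mod_cast this)
  have hprod : MeasurableSet {r : (Fin M → Bool × Bool) × ((Fin M → X) × (Fin M → X)) |
      swapPairs (fun j => (r.1 j).1) r.2 ∈ E fun j => (r.1 j).2} := by
    have : {r : (Fin M → Bool × Bool) × ((Fin M → X) × (Fin M → X)) |
        swapPairs (fun j => (r.1 j).1) r.2 ∈ E fun j => (r.1 j).2} =
        ⋃ w, {w} ×ˢ (swapPairs (fun j => (w j).1) ⁻¹' E fun j => (w j).2) := by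
      ext ⟨w, q⟩
      simp
    rw [this]
    exact MeasurableSet.iUnion fun w => (measurableSet_singleton w).prod
      ((measurePreserving_swapPairs D _).measurable (hEm _))
  calc (P.prod N) B = ∫⁻ z, P {x | (x, z) ∈ B} ∂N := Measure.prod_apply_symm hBm
    _ ≤ ∫⁻ z, 2 * (P.prod P) (E z) ∂N := lintegral_mono hghost
    _ = 2 * ∫⁻ z, (P.prod P) (E z) ∂N := lintegral_const_mul _ Measurable.of_discrete
    -- For each value of the coins the swap preserves the law of the double sample, so the coins can
    -- be averaged over at no cost.
    _ = 2 * ∫⁻ w, (P.prod P) (swapPairs (fun j => (w j).1) ⁻¹' E fun j => (w j).2)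
          ∂(Measure.pi fun _ : Fin M => coinNoise η) := by
        rw [← hτ.lintegral_comp Measurable.of_discrete]
        congr 1
        exact lintegral_congr fun w =>
          ((measurePreserving_swapPairs D _).measure_preimage (hEm _).nullMeasurableSet).symm
    _ = 2 * ((Measure.pi fun _ : Fin M => coinNoise η).prod (P.prod P))
          {r | swapPairs (fun j => (r.1 j).1) r.2 ∈ E fun j => (r.1 j).2} := by
        rw [Measure.prod_apply hprod]; rfl
    _ ≤ _ := by
        refine mul_le_mul_right ?_ 2
        rw [Measure.prod_apply_symm hprod]
        refine (lintegral_mono hcount).trans ?_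
        rw [lintegral_const, measure_univ, mul_one]

/-! ### Runs of the algorithm -/

section Run

variable {X : Type*} {n : ℕ} [NeZero n] (p : Params n)
  (A : (m : ℕ) → (Fin m → X × Bool) → X → Bool) (c : X → Bool) (ω : Outcome X p)

theorem run_tasks : (run p A c ω).tasks = p.T * p.m + n * p.T + p.M := by
  simp [run, crowdLearn, groundTruth, identifyWorker, noisyLearn, Counted.bind, forAll, compute,
    ask, callERM, add_assoc]

theorem run_steps : (run p A c ω).steps =
    p.T * (p.m + (n + p.m)) + (n * (p.T + p.T) + n) + (p.M * 2 + 1) := by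
  simp [run, crowdLearn, groundTruth, identifyWorker, noisyLearn, Counted.bind, forAll, compute,
    ask, callERM, add_assoc]

theorem run_ermCalls : (run p A c ω).ermCalls = 1 := by
  simp [run, crowdLearn, groundTruth, identifyWorker, noisyLearn, Counted.bind, forAll, compute,
    ask, callERM]

theorem run_classifier : (run p A c ω).val.2 = A p.M (noisySample c
    (fun j => ω.1 (Fin.natAdd p.T j))
    (fun j => ω.2.1 (run p A c ω).val.1 (Fin.natAdd p.T j))) := rfl

/-- If all majority votes are right and some worker makes no error on the ground-truth points, then
the worker that is identified makes no error on them either. -/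
theorem run_worker_correct
    (hmaj : ∀ t, ¬ p.m ≤ 2 * (Finset.univ.filter fun k : Fin p.m =>
      ω.2.1 (ω.2.2 t (Fin.castLE p.m_le k)) (Fin.castAdd p.M t) = true).card)
    {i₀ : Fin n} (h₀ : ∀ t, ω.2.1 i₀ (Fin.castAdd p.M t) = false) (t : Fin p.T) :
    ω.2.1 (run p A c ω).val.1 (Fin.castAdd p.M t) = false := by
  set g := (groundTruth p (answers c ω.1 ω.2.1) ω.2.2).val with hg
  have hgt : ∀ t, g t = c (ω.1 (Fin.castAdd p.M t)) := fun t => by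
    by_contra h
    exact hmaj t (le_two_mul_card_of_majority_ne _ _ h)
  set score : Fin n → ℕ := fun i => (Finset.univ.filter fun t =>
    answers c ω.1 ω.2.1 i (Fin.castAdd p.M t) = g t).card with hscore
  have hrun : (run p A c ω).val.1 = ((List.finRange n).argmax score).getD 0 := rfl
  have hagree : ∀ i t, answers c ω.1 ω.2.1 i (Fin.castAdd p.M t) = g t ↔
      ω.2.1 i (Fin.castAdd p.M t) = false := fun i t => by
    rw [hgt, answers]
    cases c (ω.1 (Fin.castAdd p.M t)) <;> cases ω.2.1 i (Fin.castAdd p.M t) <;> simp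
  -- There is at least one worker, so the default `0` of `getD` is never used.
  have hne : (List.finRange n).argmax score ≠ none := by
    rw [Ne, List.argmax_eq_none, List.finRange_eq_nil_iff]
    exact NeZero.ne n
  obtain ⟨i, hi⟩ := Option.ne_none_iff_exists'.1 hne
  rw [hrun, hi, Option.getD_some]
  have hle : score i₀ ≤ score i := List.le_of_mem_argmax (List.mem_finRange i₀) hi
  -- The error-free worker attains the largest conceivable score, so the maximiser agrees on every
  -- point, however ties are broken.
  have h₁ : score i₀ = p.T := by
    simp only [hscore, hagree, h₀]
    simp
  have h₂ : (Finset.univ.filter fun t => answers c ω.1 ω.2.1 i (Fin.castAdd p.M t) = g t) =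
      Finset.univ :=
    Finset.eq_univ_of_card _ (le_antisymm (Finset.card_le_univ _)
      (by rw [Fintype.card_fin]; exact h₁.symm.trans_le hle))
  have h₃ : t ∈ Finset.univ.filter fun t =>
      answers c ω.1 ω.2.1 i (Fin.castAdd p.M t) = g t := by rw [h₂]; exact Finset.mem_univ t
  exact (hagree i t).1 (Finset.mem_filter.1 h₃).2

end Run

/-! ### The probability of failure -/

section Failure

variable {X : Type*} [MeasurableSpace X] {n : ℕ} (D : Measure X)
  [IsProbabilityMeasure D] (W : Crowd n) (p : Params n)

instance : IsProbabilityMeasure (uniformOn (Set.univ : Set (Equiv.Perm (Fin n)))) :=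
  isProbabilityMeasure_uniformOn Set.finite_univ Set.univ_nonempty

theorem measurePreserving_noise (i : Fin n) :
    MeasurePreserving (fun ω : Outcome X p => (ω.1, ω.2.1 i)) (law D W p)
      ((Measure.pi fun _ => D).prod
        (Measure.pi fun _ => bernoulliMeasure true false (W.η i))) :=
  (MeasurePreserving.id _).prod
    ((measurePreserving_eval (fun i => Measure.pi fun _ : Fin (p.T + p.M) =>
      bernoulliMeasure true false (W.η i)) i).comp measurePreserving_fst)

theorem law_wrong_majority_le [NeZero n] (hW : W.avg ≤ 1 / 2) (t : Fin p.T) :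
    law D W p {ω | p.m ≤ 2 * (Finset.univ.filter fun k : Fin p.m =>
      ω.2.1 (ω.2.2 t (Fin.castLE p.m_le k)) (Fin.castAdd p.M t) = true).card} ≤
      ENNReal.ofReal ((1 - (1 - 2 * W.avg) ^ 2 / 2) ^ p.m) := by
  have h := Measure.le_map_apply (μ := law D W p) measurable_snd.aemeasurable
    {q | p.m ≤ 2 * (Finset.univ.filter fun k : Fin p.m =>
      q.1 (q.2 t (Fin.castLE p.m_le k)) (Fin.castAdd p.M t) = true).card}
  rw [law, measurePreserving_snd.map_eq] at h
  exact h.trans (measure_wrong_votes_le W p.m_le hW _ t)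

theorem measure_no_error {N T : ℕ} (η : unitInterval) (e : Fin T → Fin N)
    (he : Function.Injective e) :
    (Measure.pi fun _ : Fin N => bernoulliMeasure true false η)
      {z | ∀ t, z (e t) = false} = ENNReal.ofReal ((1 - η) ^ T) := by
  have h := (measurePreserving_pi_comp (bernoulliMeasure true false η) e he).measure_preimage
    (s := Set.univ.pi fun _ => {false}) MeasurableSet.of_discrete.nullMeasurableSet
  have hset : {z : Fin N → Bool | ∀ t, z (e t) = false} =
      (fun (z : Fin N → Bool) t => z (e t)) ⁻¹' Set.univ.pi fun _ => {false} := by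
    ext z; simp
  rw [hset, h, Measure.pi_pi]
  have h1 : bernoulliMeasure true false η {false} = ENNReal.ofReal (1 - η) := by
    rw [← lintegral_indicator_one (MeasurableSet.singleton _), lintegral_bernoulli]
    simp
  rw [Finset.prod_const, Finset.card_univ, Fintype.card_fin, h1,
    ENNReal.ofReal_pow (by linarith [η.2.2])]

theorem law_no_error (i : Fin n) :
    law D W p {ω | ∀ t, ω.2.1 i (Fin.castAdd p.M t) = false} =
      ENNReal.ofReal ((1 - W.η i) ^ p.T) := by
  have h := (measurePreserving_snd.comp (measurePreserving_noise D W p i)).measure_preimage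
    (s := {z | ∀ t, z (Fin.castAdd p.M t) = false}) MeasurableSet.of_discrete.nullMeasurableSet
  exact h.trans (measure_no_error _ _ (Fin.castAdd_injective _ _))

/-- Only an inequality is stated because `Measure.le_map_apply` holds for every set; no
measurability of `S` is then needed. -/
theorem law_fresh_le (i : Fin n) (S : Set ((Fin p.M → X) × (Fin p.M → Bool))) :
    law D W p {ω | ((fun j => ω.1 (Fin.natAdd p.T j)), fun j => ω.2.1 i (Fin.natAdd p.T j)) ∈ S} ≤
      ((Measure.pi fun _ : Fin p.M => D).prod
        (Measure.pi fun _ : Fin p.M => bernoulliMeasure true false (W.η i))) S := by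
  have hinj : Function.Injective (Fin.natAdd (m := p.M) p.T) := fun _ _ h => by
    simpa using h
  have h := ((measurePreserving_pi_comp D _ hinj).prod
    (measurePreserving_pi_comp (bernoulliMeasure true false (W.η i)) _ hinj)).comp
    (measurePreserving_noise D W p i)
  rw [← h.map_eq]
  exact Measure.le_map_apply h.measurable.aemeasurable S

/-- The budget is `δ/2` for all majority votes together and `δ/(2n)` for each worker; an error of
the perfect worker has probability zero. -/
theorem law_failure_le [NeZero n] {A : (m : ℕ) → (Fin m → X × Bool) → X → Bool} {c : X → Bool}
    {ε δ : ℝ} (hδ : 0 ≤ δ) (hW : W.avg ≤ 1 / 2) (hperf : ∃ i, (W.η i : ℝ) = 0)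
    (hmaj : p.T * (1 - (1 - 2 * W.avg) ^ 2 / 2) ^ p.m ≤ δ / 2)
    (hT : (3 / 4 : ℝ) ^ p.T ≤ δ / (2 * n))
    (hM : ∀ η : unitInterval, (η : ℝ) ≤ 1 / 4 →
      ((Measure.pi fun _ : Fin p.M => D).prod
        (Measure.pi fun _ : Fin p.M => bernoulliMeasure true false η))
        {q | ε ≤ err D (A p.M (noisySample c q.1 q.2)) c} ≤ ENNReal.ofReal (δ / (2 * n))) :
    law D W p {ω | ¬ W.IsOptimal (1 / 4) (run p A c ω).val.1 ∨
      ε ≤ err D (run p A c ω).val.2 c} ≤ ENNReal.ofReal δ := by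
  classical
  obtain ⟨i₀, hi₀⟩ := hperf
  have hbest : W.best = 0 := le_antisymm
    (hi₀ ▸ ciInf_le ⟨0, by rintro _ ⟨i, rfl⟩; exact (W.η i).2.1⟩ i₀)
    (Real.iInf_nonneg fun i => (W.η i).2.1)
  set G : Fin p.T → Set (Outcome X p) := fun t => {ω | p.m ≤ 2 * (Finset.univ.filter
    fun k : Fin p.m => ω.2.1 (ω.2.2 t (Fin.castLE p.m_le k)) (Fin.castAdd p.M t) = true).card}
    with hG
  set Z : Set (Outcome X p) := {ω | ∀ t, ω.2.1 i₀ (Fin.castAdd p.M t) = false}ᶜ with hZ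
  -- Each worker has one bad event, according to its noise rate: a good one teaches a bad classifier
  -- on the fresh points, a poor one looks perfect on the ground-truth points. Neither event
  -- mentions which worker is picked.
  set F : Fin n → Set (Outcome X p) := fun i => if (W.η i : ℝ) ≤ 1 / 4 then
    {ω | ((fun j => ω.1 (Fin.natAdd p.T j)), fun j => ω.2.1 i (Fin.natAdd p.T j)) ∈
      {q : (Fin p.M → X) × (Fin p.M → Bool) | ε ≤ err D (A p.M (noisySample c q.1 q.2)) c}}
    else {ω | ∀ t, ω.2.1 i (Fin.castAdd p.M t) = false} with hF
  have hsub : {ω | ¬ W.IsOptimal (1 / 4) (run p A c ω).val.1 ∨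
      ε ≤ err D (run p A c ω).val.2 c} ⊆ ((⋃ t, G t) ∪ Z) ∪ ⋃ i, F i := by
    intro ω hω
    by_contra hnot
    simp only [Set.mem_union, Set.mem_iUnion, not_or, not_exists] at hnot
    obtain ⟨⟨h1, h2⟩, h3⟩ := hnot
    have hz : ∀ t, ω.2.1 i₀ (Fin.castAdd p.M t) = false := by
      simpa [hZ] using h2
    have hcorr := run_worker_correct p A c ω h1 hz
    have h4 := h3 (run p A c ω).val.1
    by_cases hη : (W.η (run p A c ω).val.1 : ℝ) ≤ 1 / 4
    · simp only [hF, if_pos hη] at h4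
      rcases hω with hω | hω
      · exact hω (by rw [Crowd.IsOptimal, hbest, zero_add]; exact hη)
      · exact h4 hω
    · simp only [hF, if_neg hη] at h4
      exact h4 hcorr
  have hZ0 : law D W p Z = 0 := by
    have hm : Measurable fun ω : Outcome X p => ω.2.1 i₀ :=
      (measurable_pi_apply i₀).comp (measurable_fst.comp measurable_snd)
    have hms : MeasurableSet {ω : Outcome X p | ∀ t, ω.2.1 i₀ (Fin.castAdd p.M t) = false} :=
      hm (MeasurableSet.of_discrete (s := {z : Fin (p.T + p.M) → Bool |
        ∀ t : Fin p.T, z (Fin.castAdd p.M t) = false}))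
    have : IsProbabilityMeasure (law D W p) := by unfold law; infer_instance
    rw [hZ, prob_compl_eq_zero_iff hms, law_no_error, hi₀]
    simp
  have hn : (0 : ℝ) < n := by exact_mod_cast Nat.pos_of_ne_zero (NeZero.ne n)
  have hFi : ∀ i, law D W p (F i) ≤ ENNReal.ofReal (δ / (2 * n)) := by
    intro i
    by_cases hη : (W.η i : ℝ) ≤ 1 / 4
    · simp only [hF, if_pos hη]
      exact (law_fresh_le D W p i _).trans (hM _ hη)
    · simp only [hF, if_neg hη]
      rw [law_no_error]
      refine ENNReal.ofReal_le_ofReal (le_trans ?_ hT)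
      exact pow_le_pow_left₀ (by linarith [(W.η i).2.2]) (by linarith) _
  calc _ ≤ law D W p (((⋃ t, G t) ∪ Z) ∪ ⋃ i, F i) := measure_mono hsub
    _ ≤ (∑ t, law D W p (G t) + 0) + ∑ i, law D W p (F i) := by
        refine (measure_union_le _ _).trans (add_le_add ((measure_union_le _ _).trans ?_)
          (measure_iUnion_fintype_le _ _))
        rw [hZ0]
        exact add_le_add_left (measure_iUnion_fintype_le _ _) _
    _ ≤ (∑ _t : Fin p.T, ENNReal.ofReal ((1 - (1 - 2 * W.avg) ^ 2 / 2) ^ p.m) + 0) +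
          ∑ _i : Fin n, ENNReal.ofReal (δ / (2 * n)) := by
        gcongr with t _ i _
        · exact law_wrong_majority_le D W p hW t
        · exact hFi i
    _ ≤ ENNReal.ofReal (δ / 2) + ENNReal.ofReal (δ / 2) := by
        simp only [Finset.sum_const, Finset.card_univ, Fintype.card_fin, nsmul_eq_mul, add_zero]
        rw [← ENNReal.ofReal_natCast, ← ENNReal.ofReal_natCast,
          ← ENNReal.ofReal_mul (Nat.cast_nonneg _), ← ENNReal.ofReal_mul (Nat.cast_nonneg _)]
        refine add_le_add (ENNReal.ofReal_le_ofReal hmaj) (ENNReal.ofReal_le_ofReal (le_of_eq ?_))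
        field_simp
    _ = ENNReal.ofReal δ := by
        rw [← ENNReal.ofReal_add (by linarith) (by linarith), add_halves]

end Failure

/-! ### The choice of the parameters -/

/-- The number of ground-truth points. -/
noncomputable def numTruth (n : ℕ) (δ : ℝ) : ℕ := ⌈12 * Real.log (n / δ)⌉₊

/-- The number of voters for each ground-truth point. -/
noncomputable def numVoters (n : ℕ) (δ a : ℝ) : ℕ :=
  ⌈40 * Real.log (Real.log (n / δ) / δ) / (1 - 2 * a) ^ 2⌉₊

/-- The number of fresh points. -/
noncomputable def numFresh (n d : ℕ) (ε δ : ℝ) : ℕ :=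
  ⌈1000 * (d / ε * (Real.log (2 + d / ε) + Real.log (n / δ)))⌉₊

section Parameters

variable {n : ℕ} {δ : ℝ}

theorem two_le_ratio (hn : 0 < n) (hδ : 0 < δ) (hδ2 : δ ≤ 1 / 2) : 2 ≤ (n : ℝ) / δ := by
  have : (1 : ℝ) ≤ n := by exact_mod_cast hn
  rw [le_div_iff₀ hδ]; linarith

theorem log_ratio_ge (hn : 0 < n) (hδ : 0 < δ) (hδ2 : δ ≤ 1 / 2) :
    0.69 ≤ Real.log (n / δ) := by
  have := Real.log_le_log two_pos (two_le_ratio hn hδ hδ2)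
  linarith [Real.log_two_gt_d9]

theorem exp_neg_log_ratio (hn : 0 < n) (hδ : 0 < δ) :
    Real.exp (-Real.log (n / δ)) = δ / n := by
  have : (0 : ℝ) < n := by exact_mod_cast hn
  rw [Real.exp_neg, Real.exp_log (by positivity), inv_div]

theorem numTruth_le (hn : 0 < n) (hδ : 0 < δ) (hδ2 : δ ≤ 1 / 2) :
    (numTruth n δ : ℝ) ≤ 14 * Real.log (n / δ) := by
  have hL := log_ratio_ge hn hδ hδ2
  have := (Nat.ceil_lt_add_one (show 0 ≤ 12 * Real.log (n / δ) by linarith)).le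
  unfold numTruth
  linarith

theorem pow_numTruth_le (hn : 0 < n) (hδ : 0 < δ) (hδ2 : δ ≤ 1 / 2) :
    (3 / 4 : ℝ) ^ numTruth n δ ≤ δ / (2 * n) := by
  have hn0 : (0 : ℝ) < n := by exact_mod_cast hn
  have hT : 12 * Real.log (n / δ) ≤ numTruth n δ := Nat.le_ceil _
  have hy : δ / n ≤ 1 / 2 := by
    have := two_le_ratio hn hδ hδ2
    rw [← inv_div, one_div]
    exact inv_anti₀ two_pos this
  have hy0 : 0 < δ / n := by positivity
  calc (3 / 4 : ℝ) ^ numTruth n δ ≤ Real.exp (-(1 / 4)) ^ numTruth n δ :=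
        pow_le_pow_left₀ (by norm_num) (by linarith [Real.add_one_le_exp (-(1 / 4) : ℝ)]) _
    _ = Real.exp (numTruth n δ * -(1 / 4)) := by rw [← Real.exp_nat_mul]
    _ ≤ Real.exp ((3 : ℕ) * -Real.log (n / δ)) := Real.exp_le_exp.2 (by push_cast; linarith)
    _ = (δ / n) ^ 3 := by rw [Real.exp_nat_mul, exp_neg_log_ratio hn hδ]
    _ ≤ (δ / n) / 2 := by nlinarith [mul_pos hy0 hy0]
    _ = δ / (2 * n) := by field_simp

theorem majority_budget (hn : 0 < n) (hδ : 0 < δ) (hδ2 : δ ≤ 1 / 2) {a : ℝ} (ha0 : 0 ≤ a)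
    (ha : a < 1 / 2) :
    numTruth n δ * (1 - (1 - 2 * a) ^ 2 / 2) ^ numVoters n δ a ≤ δ / 2 := by
  set L := Real.log (n / δ) with hLdef
  have hL := log_ratio_ge hn hδ hδ2
  rw [← hLdef] at hL
  have hL0 : 0 < L := by linarith
  set γ := 1 - 2 * a with hγ
  have hγ0 : 0 < γ := by linarith
  have hγ1 : γ ≤ 1 := by linarith
  have hm : 40 * Real.log (L / δ) / γ ^ 2 ≤ numVoters n δ a := Nat.le_ceil _
  have hm' : 20 * Real.log (L / δ) ≤ numVoters n δ a * (γ ^ 2 / 2) := by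
    rw [div_le_iff₀ (by positivity)] at hm
    linarith
  -- `L` may be as small as `log 2`, so `δ/L` is only bounded by a constant below `1`. The large
  -- exponent `20` makes up for this: one factor absorbs `L`, and `14 · (3/4)^19 ≤ 1/2`.
  have hy : δ / L ≤ 3 / 4 := by rw [div_le_iff₀ hL0]; linarith
  have hy0 : 0 < δ / L := by positivity
  have h1 : (1 - γ ^ 2 / 2) ^ numVoters n δ a ≤ (δ / L) ^ 20 := by
    calc (1 - γ ^ 2 / 2) ^ numVoters n δ a ≤ Real.exp (-(γ ^ 2 / 2)) ^ numVoters n δ a :=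
          pow_le_pow_left₀ (by nlinarith) (by linarith [Real.add_one_le_exp (-(γ ^ 2 / 2))]) _
      _ = Real.exp (numVoters n δ a * -(γ ^ 2 / 2)) := by rw [← Real.exp_nat_mul]
      _ ≤ Real.exp ((20 : ℕ) * -Real.log (L / δ)) := Real.exp_le_exp.2 (by push_cast; linarith)
      _ = (δ / L) ^ 20 := by
          rw [Real.exp_nat_mul, Real.exp_neg, Real.exp_log (by positivity), inv_div]
  calc numTruth n δ * (1 - γ ^ 2 / 2) ^ numVoters n δ a ≤ (14 * L) * (δ / L) ^ 20 :=
        mul_le_mul (numTruth_le hn hδ hδ2) h1 (pow_nonneg (by nlinarith) _) (by positivity)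
    _ = 14 * δ * (δ / L) ^ 19 := by field_simp
    _ ≤ 14 * δ * (3 / 4) ^ 19 := by gcongr
    _ ≤ δ / 2 := by nlinarith

theorem learning_budget (hn : 0 < n) (hδ : 0 < δ) (hδ2 : δ ≤ 1 / 2) {d : ℕ} (hd : 0 < d) {ε : ℝ}
    (hε : 0 < ε) (hε1 : ε ≤ 1) :
    4 ≤ ε * numFresh n d ε δ ∧
      2 * ((2 * numFresh n d ε δ + 1) ^ d * (8 / 9 : ℝ) ^ ⌊ε * numFresh n d ε δ / 4⌋₊) ≤
        δ / (2 * n) := by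
  have hn0 : (0 : ℝ) < n := by exact_mod_cast hn
  have hd1 : (1 : ℝ) ≤ d := by exact_mod_cast hd
  set L := Real.log (n / δ) with hLdef
  have hL : 0.69 ≤ L := log_ratio_ge hn hδ hδ2
  set u := (d : ℝ) / ε with hu
  have hu1 : 1 ≤ u := by rw [hu, le_div_iff₀ hε]; linarith
  have hεu : ε * u = d := by rw [hu]; field_simp
  set Λ := Real.log (2 + u) + L with hΛ
  have hlu : 0.69 ≤ Real.log (2 + u) := by
    have := Real.log_le_log two_pos (show (2 : ℝ) ≤ 2 + u by linarith)
    linarith [Real.log_two_gt_d9]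
  have hΛ1 : 1.38 ≤ Λ := by linarith
  set M := numFresh n d ε δ with hM
  have hMle : (M : ℝ) ≤ 1000 * (u * Λ) + 1 :=
    (Nat.ceil_lt_add_one (show 0 ≤ 1000 * (u * Λ) by positivity)).le
  have hMge : 1000 * (u * Λ) ≤ M := Nat.le_ceil _
  have hεM : 1000 * (d * Λ) ≤ ε * M := by
    calc 1000 * (d * Λ) = ε * (1000 * (u * Λ)) := by rw [← hεu]; ring
      _ ≤ _ := mul_le_mul_of_nonneg_left hMge hε.le
  have hdΛ : Λ ≤ d * Λ := le_mul_of_one_le_left (by linarith) hd1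
  refine ⟨by linarith, ?_⟩
  have huΛ : 1 ≤ u * Λ := one_le_mul_of_one_le_of_one_le hu1 (by linarith)
  -- `M` itself contains `Λ`, but only `log Λ ≤ Λ - 1` enters here, so the growth function costs at
  -- most `exp (8dΛ)`.
  have hlogM : Real.log (2 * M + 1) ≤ 8 * Λ := by
    have h1 : Real.log (2 * M + 1) ≤ Real.log (2 ^ 11 * (u * Λ)) :=
      Real.log_le_log (by positivity) (by norm_num; linarith)
    rw [Real.log_mul (by norm_num) (by positivity), Real.log_mul (by positivity) (by positivity),
      Real.log_pow] at h1
    have h2 : Real.log u ≤ Real.log (2 + u) := Real.log_le_log (by linarith) (by linarith)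
    have h3 := Real.log_le_sub_one_of_pos (show 0 < Λ by linarith)
    have h4 := Real.log_two_lt_d9
    push_cast at h1
    linarith
  have e1 : (2 * (M : ℝ) + 1) ^ d ≤ Real.exp (d * (8 * Λ)) := by
    rw [Real.exp_nat_mul]
    refine pow_le_pow_left₀ (by positivity) ?_ d
    rw [← Real.log_le_iff_le_exp (by positivity)]
    exact hlogM
  -- Here `27 ≤ 1000/(4 · 9)`, and the summand `1/9` pays for the floor.
  have e2 : (8 / 9 : ℝ) ^ ⌊ε * M / 4⌋₊ ≤ Real.exp (-(27 * (d * Λ)) + 1 / 9) := by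
    have hk := Nat.lt_floor_add_one (ε * M / 4)
    calc (8 / 9 : ℝ) ^ ⌊ε * M / 4⌋₊ ≤ Real.exp (-(1 / 9)) ^ ⌊ε * M / 4⌋₊ :=
          pow_le_pow_left₀ (by norm_num) (by linarith [Real.add_one_le_exp (-(1 / 9) : ℝ)]) _
      _ = Real.exp (⌊ε * M / 4⌋₊ * -(1 / 9)) := by rw [← Real.exp_nat_mul]
      _ ≤ _ := Real.exp_le_exp.2 (by linarith)
  have hy : δ / n ≤ 1 / 2 := by
    have := two_le_ratio hn hδ hδ2
    rw [← inv_div, one_div]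
    exact inv_anti₀ two_pos this
  have hy0 : 0 < δ / n := by positivity
  calc 2 * ((2 * (M : ℝ) + 1) ^ d * (8 / 9 : ℝ) ^ ⌊ε * M / 4⌋₊)
      ≤ Real.exp 1 * (Real.exp (d * (8 * Λ)) * Real.exp (-(27 * (d * Λ)) + 1 / 9)) := by
        gcongr
        linarith [Real.add_one_le_exp (1 : ℝ)]
    _ = Real.exp (1 + (d * (8 * Λ) + (-(27 * (d * Λ)) + 1 / 9))) := by
        rw [← Real.exp_add, ← Real.exp_add]
    _ ≤ Real.exp ((2 : ℕ) * -L) := Real.exp_le_exp.2 (by push_cast; linarith)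
    _ = (δ / n) ^ 2 := by rw [Real.exp_nat_mul, hLdef, exp_neg_log_ratio hn hδ]
    _ ≤ (δ / n) / 2 := by nlinarith
    _ = δ / (2 * n) := by field_simp

/-- The resources that the parameters require. -/
theorem resources_le (hn : 0 < n) (hδ : 0 < δ) (hδ2 : δ ≤ 1 / 2) (d : ℕ) {ε : ℝ} (hε : 0 < ε)
    (a : ℝ) :
    5 * (n * numTruth n δ) + n + 2 * numFresh n d ε δ + 1 ≤
      softBound 30000 1 (rate n d ε δ a) := by
  have hn1 : (1 : ℝ) ≤ n := by exact_mod_cast hn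
  set g := rate n d ε δ a with hg
  set G := Real.log (2 + g) with hG
  set l := Real.log (1 / δ) with hl
  set u := (d : ℝ) / ε with hu
  have hu0 : 0 ≤ u := by positivity
  have hl1 : 0.69 ≤ l := by
    have h2 : 2 ≤ 1 / δ := by rw [le_div_iff₀ hδ]; linarith
    linarith [Real.log_le_log two_pos h2, Real.log_two_gt_d9]
  have hLeq : Real.log (n / δ) = Real.log n + l := by
    rw [hl, div_eq_mul_one_div, Real.log_mul (by positivity) (by positivity)]
  -- The second summand of `rate` suffices: because `m ≤ n`, the votes cost no more than asking all
  -- workers in Step 2.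
  have hgge : (n + u) * l ≤ g := by
    have : 0 ≤ Real.log (n / δ) ^ 2 / (1 - 2 * a) ^ 2 := by positivity
    rw [hg, rate]; linarith
  have hnl : 0 ≤ n * l := by positivity
  have hul : 0 ≤ u * l := by positivity
  have hng : (n : ℝ) ≤ 2 * g := by nlinarith
  have hug : u ≤ 2 * g := by nlinarith
  have hg0 : 0 ≤ g := by linarith
  -- Since `2 + 2g ≤ (2 + g)²`, both `log n` and `log (2 + u)` cost one factor `G`, which is why `k
  -- = 1` is enough.
  have hlog : ∀ x, 0 < x → x ≤ 2 + 2 * g → Real.log x ≤ 2 * G := by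
    intro x hx hxg
    have h := Real.log_le_log hx (show x ≤ (2 + g) ^ 2 by nlinarith)
    rw [Real.log_pow] at h
    exact_mod_cast h
  have hln : Real.log n ≤ 2 * G := hlog n (by linarith) (by linarith)
  have hlu : Real.log (2 + u) ≤ 2 * G := hlog _ (by linarith) (by linarith)
  have hG1 : 1 / 2 ≤ G := by
    have := Real.log_le_log two_pos (show (2 : ℝ) ≤ 2 + g by linarith)
    linarith [Real.log_two_gt_d9]
  have hgG : g ≤ 2 * (g * G) := by nlinarith
  have hprod : ∀ x y, 0 ≤ x → x ≤ 2 * g → y ≤ 2 * G → x * y ≤ 4 * (g * G) := by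
    intro x y hx hxg hy
    calc x * y ≤ x * (2 * G) := mul_le_mul_of_nonneg_left hy hx
      _ ≤ (2 * g) * (2 * G) := mul_le_mul_of_nonneg_right hxg (by linarith)
      _ = _ := by ring
  have hnL : n * Real.log (n / δ) ≤ 6 * (g * G) := by
    rw [hLeq, mul_add]
    have := hprod n _ (by linarith) hng hln
    linarith
  have huΛ : u * (Real.log (2 + u) + Real.log (n / δ)) ≤ 10 * (g * G) := by
    rw [hLeq, mul_add, mul_add]
    have h1 := hprod u _ hu0 hug hln
    have h2 := hprod u _ hu0 hug hlu
    linarith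
  have hT : n * (numTruth n δ : ℝ) ≤ 84 * (g * G) := by
    have := mul_le_mul_of_nonneg_left (numTruth_le hn hδ hδ2) (show (0 : ℝ) ≤ n by linarith)
    linarith
  have hM : (numFresh n d ε δ : ℝ) ≤ 10000 * (g * G) + 1 := by
    have hL := log_ratio_ge hn hδ hδ2
    have hlu0 : 0 ≤ Real.log (2 + u) := Real.log_nonneg (by linarith)
    have := (Nat.ceil_lt_add_one (show 0 ≤ 1000 * (u * (Real.log (2 + u) + Real.log (n / δ))) by
      positivity)).le
    have h2 : (numFresh n d ε δ : ℝ) ≤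
      1000 * (u * (Real.log (2 + u) + Real.log (n / δ))) + 1 := this
    linarith
  rw [softBound, pow_one, mul_assoc]
  change _ ≤ 30000 * (g * G)
  linarith

end Parameters

/-- Two hypotheses that differ at a point shatter it. This settles `d = 0`, where `numFresh` is `0`
and sampling bounds say nothing. -/
theorem eq_of_vcDim_zero {X : Type*} {C : Set (X → Bool)}
    (hC : ∀ s : Finset X, Shatters C s → s.card ≤ 0) {h c : X → Bool} (hh : h ∈ C) (hc : c ∈ C) :
    h = c := by
  by_contra hne
  obtain ⟨x, hx⟩ := Function.ne_iff.1 hne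
  have := hC {x} fun f => by
    by_cases hf : h x = f x
    · exact ⟨h, hh, by simpa using hf⟩
    · refine ⟨c, hc, ?_⟩
      simp only [Finset.mem_singleton, forall_eq]
      revert hx hf
      cases h x <;> cases c x <;> cases f x <;> simp
  simp at this

/-- With the chosen number of fresh points, disagreement minimisation succeeds. -/
theorem measure_noisy_erm_numFresh_le {X : Type*} [MeasurableSpace X] (D : Measure X)
    [IsProbabilityMeasure D] {C : Set (X → Bool)} {d : ℕ}
    (hC : ∀ s : Finset X, Shatters C s → s.card ≤ d)
    {A : (m : ℕ) → (Fin m → X × Bool) → X → Bool} (hA : IsERM C A) {c : X → Bool} (hc : c ∈ C)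
    (hcm : Measurable c) (η : unitInterval) (hη : (η : ℝ) ≤ 1 / 4) {ε δ : ℝ} (hε : 0 < ε) {n : ℕ}
    (hn : 0 < n) (hδ : 0 < δ) (hδ2 : δ ≤ 1 / 2) {M : ℕ} (hM : M = numFresh n d ε δ) :
    ((Measure.pi fun _ : Fin M => D).prod
      (Measure.pi fun _ : Fin M => bernoulliMeasure true false η))
      {q | ε ≤ err D (A M (noisySample c q.1 q.2)) c} ≤ ENNReal.ofReal (δ / (2 * n)) := by
  subst hM
  rcases Nat.eq_zero_or_pos d with rfl | hd
  · refine (congrArg _ (Set.eq_empty_of_forall_notMem fun q hq => ?_)).trans_le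
      (measure_empty.trans_le zero_le)
    simp only [Set.mem_ofPred_eq, err, eq_of_vcDim_zero hC (hA.mem _ _) hc] at hq
    simp at hq
    linarith
  rcases le_or_gt ε 1 with hε1 | hε1
  · obtain ⟨h4, hle⟩ := learning_budget hn hδ hδ2 hd hε hε1
    refine (measure_noisy_erm_le D hC hA hc hcm η hη h4).trans ?_
    have h2 : (2 : ENNReal) = ENNReal.ofReal 2 := by simp
    rw [h2, ← ENNReal.ofReal_mul two_pos.le]
    exact ENNReal.ofReal_le_ofReal hle
  · refine (congrArg _ (Set.eq_empty_of_forall_notMem fun q hq => ?_)).trans_le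
      (measure_empty.trans_le zero_le)
    have hq' : ε ≤ err D (A _ (noisySample c q.1 q.2)) c := hq
    have : err D (A _ (noisySample c q.1 q.2)) c ≤ 1 := measureReal_le_one
    linarith

end CrowdPAC

theorem theorem6 :
    -- universal constants
    ∃ (c₀ K : ℝ) (k : ℕ), 0 < c₀ ∧ 0 < K ∧
      ∀ (n : ℕ) [NeZero n] (d : ℕ) (ε δ a : ℝ), 0 < ε → 0 < δ → δ ≤ 1 / 2 → a < 1 / 2 →
        -- the crowd is large enough for the majority votes
        c₀ * Real.log (Real.log (n / δ) / δ) / (1 - 2 * a) ^ 2 ≤ n →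
        ∃ p : Params n,
          ∀ (X : Type*) [MeasurableSpace X] (D : Measure X) [IsProbabilityMeasure D]
            (C : Set (X → Bool)) (_ : ∀ h ∈ C, Measurable h) (_ : HasVCDim C d)
            (A : (m : ℕ) → (Fin m → X × Bool) → X → Bool) (_ : IsERM C A)
            (c : X → Bool) (_ : c ∈ C)
            (W : Crowd n) (_ : W.avg = a) (_ : ∃ i, (W.η i : ℝ) = 0),
            -- data points drawn, tasks, steps, and calls of the disagreement minimiser
            ((p.T + p.M : ℕ) : ℝ) ≤ softBound K k (rate n d ε δ a) ∧
            (∀ ω : Outcome X p,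
              ((run p A c ω).tasks : ℝ) ≤ softBound K k (rate n d ε δ a) ∧
              ((run p A c ω).steps : ℝ) ≤ softBound K k (rate n d ε δ a) ∧
              (run p A c ω).ermCalls = 1 ∧ (run p A c ω).val.2 ∈ C) ∧
            -- Step 2 finds a `1/4`-optimal worker and the classifier is `ε`-accurate
            law D W p {ω | ¬ W.IsOptimal (1 / 4) (run p A c ω).val.1 ∨
              ε ≤ err D (run p A c ω).val.2 c} ≤ ENNReal.ofReal δ := by
  -- `40` is the constant in `numVoters`, so the assumption on the crowd size is exactly what gives
  -- `m ≤ n`.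
  refine ⟨40, 30000, 1, by norm_num, by norm_num, ?_⟩
  intro n _ d ε δ a hε hδ hδ2 ha hcrowd
  have hn : 0 < n := Nat.pos_of_ne_zero (NeZero.ne n)
  refine ⟨⟨numTruth n δ, numVoters n δ a, numFresh n d ε δ, Nat.ceil_le.2 hcrowd⟩, ?_⟩
  intro X _ D _ C hCm hVC A hA c hc W hW hperf
  set p : Params n := ⟨numTruth n δ, numVoters n δ a, numFresh n d ε δ, Nat.ceil_le.2 hcrowd⟩
  have hres : 5 * ((n : ℝ) * p.T) + n + 2 * p.M + 1 ≤ softBound 30000 1 (rate n d ε δ a) :=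
    resources_le hn hδ hδ2 d hε a
  have hTm : p.T * p.m ≤ n * p.T := by
    rw [mul_comm]; exact Nat.mul_le_mul_right _ p.m_le
  have hTn : p.T ≤ n * p.T := Nat.le_mul_of_pos_left _ hn
  have hbound : ∀ r : ℕ, r ≤ 5 * (n * p.T) + n + 2 * p.M + 1 →
      (r : ℝ) ≤ softBound 30000 1 (rate n d ε δ a) := fun r hr =>
    le_trans (by exact_mod_cast hr) hres
  refine ⟨hbound _ (by omega), fun ω => ⟨hbound _ ?_, hbound _ ?_, run_ermCalls p A c ω,
    hA.mem _ _⟩, ?_⟩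
  · rw [run_tasks]; omega
  · rw [run_steps, mul_add, mul_add, mul_add, mul_comm p.T n]; omega
  · have ha0 : 0 ≤ a := by
      rw [← hW, Crowd.avg]
      exact div_nonneg (Finset.sum_nonneg fun i _ => (W.η i).2.1) (Nat.cast_nonneg n)
    refine law_failure_le D W p hδ.le (by rw [hW]; exact ha.le) hperf ?_
      (pow_numTruth_le hn hδ hδ2) fun η hη => ?_
    · rw [hW]; exact majority_budget hn hδ hδ2 ha0 ha
    · exact measure_noisy_erm_numFresh_le D hVC.2 hA hc (hCm c hc) η hη hε hn hδ hδ2 rfl
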